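/- All vector spaces are over $\mathbb{C}$. For $n \ge 2$ let $\mathfrak{g} = \mathfrak{p}(n)$ be the periplectic Lie superalgebra, i.e. the Lie subsuperalgebra of $\mathfrak{gl}(n+1,n+1)$ consisting of the block matrices $\begin{pmatrix} X & Y \\ Z & -X^t \end{pmatrix}$ with $X \in \mathfrak{sl}_{n+1}$, $Y^t = Y$ and $Z^t = -Z$. Let $A$ be a nonzero finitely generated commutative associative $\mathbb{C}$-algebra with unit, and let $\mathfrak{g} \otimes A$ be the Lie superalgebra with $(\mathfrak{g}\otimes A)_z = \mathfrak{g}_z \otimes A$ for $z \in \mathbb{Z}_2$ and bracket $[x \otimes a, y \otimes b] = [x,y] \otimes ab$. For a maximal ideal $\mathsf{m}$ of $A$ let $\mathrm{ev}_{\mathsf{m}} \colon \mathfrak{g} \otimes A \to \mathfrak{g} \otimes A/\mathsf{m} \cong \mathfrak{g}$ be the evaluation homomorphism (recall $A/\mathsf{m} \cong \mathbb{C}$) and, for a $\mathfrak{g}$-module $W$, let $\mathrm{ev}_{\mathsf{m}}(W)$ be the evaluation module, the pull-back of $W$ along $\mathrm{ev}_{\mathsf{m}}$. Modules are $\mathbb{Z}_2$-graded,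 a module is irreducible if it is nonzero and has no $\mathbb{Z}_2$-graded submodules other than $0$ and itself, and isomorphisms preserve the $\mathbb{Z}_2$-grading. Then every finite-dimensional irreducible $\mathfrak{g} \otimes A$-module $V$ is isomorphic to a tensor product of evaluation modules: there are $\ell \ge 0$, pairwise distinct maximal ideals $\mathsf{m}_1, \dots, \mathsf{m}_\ell$ of $A$ and finite-dimensional irreducible $\mathfrak{g}$-modules $W_1, \dots, W_\ell$ such that $$V \cong \mathrm{ev}_{\mathsf{m}_1}(W_1) \otimes \dots \otimes \mathrm{ev}_{\mathsf{m}_\ell}(W_\ell),$$ where the empty tensor product is the trivial module $\mathbb{C}$ in even degree. -/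

import Mathlib

open scoped TensorProduct

universe u v

noncomputable section

/-! ### Super spaces -/

/-- A super space structure on a complex vector space: a decomposition `V = V₀ ⊕ V₁`
indexed by `ℤ/2`. -/
structure SuperSpace (V : Type*) [AddCommGroup V] [Module ℂ V] where
  part : ZMod 2 → Submodule ℂ V
  isCompl : IsCompl (part 0) (part 1)

/-- The sign `(-1)^{ij}` for `i, j ∈ ℤ/2`. -/
def superSign (i j : ZMod 2) : ℂ := if i = 1 ∧ j = 1 then -1 else 1

theorem zmod_two_cases (i : ZMod 2) : i = 0 ∨ i = 1 := by
  revert i; decide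

theorem zmod_two_one_add_one : (1 + 1 : ZMod 2) = 0 := by decide

@[simp] theorem superSign_zero_left (j : ZMod 2) : superSign 0 j = 1 := by simp [superSign]

@[simp] theorem superSign_zero_right (i : ZMod 2) : superSign i 0 = 1 := by simp [superSign]

@[simp] theorem superSign_one_one : superSign 1 1 = -1 := by simp [superSign]

/-- Two subspaces that span and on which a linear map acts by `1` and `-1` are complementary. -/
theorem isCompl_of_parity {V : Type*} [AddCommGroup V] [Module ℂ V] {p q : Submodule ℂ V}
    (P : V →ₗ[ℂ] V) (hp : ∀ x ∈ p, P x = x) (hq : ∀ x ∈ q, P x = -x)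
    (h : ∀ x, x ∈ p ⊔ q) : IsCompl p q := by
  refine ⟨?_, ?_⟩
  · rw [Submodule.disjoint_def]
    intro x h1 h2
    have h3 : x = -x := (hp x h1).symm.trans (hq x h2)
    have h4 : (2 : ℂ) • x = 0 := by rw [two_smul]; nth_rewrite 2 [h3]; exact add_neg_cancel x
    exact (smul_eq_zero.mp h4).resolve_left two_ne_zero
  · rw [codisjoint_iff, eq_top_iff]
    exact fun x _ => h x

namespace SuperSpace

variable {V W : Type*} [AddCommGroup V] [Module ℂ V] [AddCommGroup W] [Module ℂ W]

/-- The projection of a super space onto its component of degree `i`. -/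
def proj (S : SuperSpace V) (i : ZMod 2) : V →ₗ[ℂ] V :=
  if i = 0 then (S.part 0).projection (S.part 1) S.isCompl
  else (S.part 1).projection (S.part 0) S.isCompl.symm

theorem proj_zero_add_proj_one (S : SuperSpace V) (x : V) :
    S.proj 0 x + S.proj 1 x = x := by
  simp [proj, Submodule.projection_add_projection_eq_self]

theorem proj_mem (S : SuperSpace V) (i : ZMod 2) (x : V) : S.proj i x ∈ S.part i := by
  rcases zmod_two_cases i with rfl | rfl <;> simp [proj]

theorem proj_self (S : SuperSpace V) {i : ZMod 2} {x : V} (hx : x ∈ S.part i) :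
    S.proj i x = x := by
  rcases zmod_two_cases i with rfl | rfl
  · simpa [proj] using Submodule.projection_apply_left S.isCompl ⟨x, hx⟩
  · simpa [proj] using Submodule.projection_apply_left S.isCompl.symm ⟨x, hx⟩

theorem proj_of_ne (S : SuperSpace V) {i j : ZMod 2} (hij : i ≠ j) {x : V}
    (hx : x ∈ S.part i) : S.proj j x = 0 := by
  rcases zmod_two_cases i with rfl | rfl <;> rcases zmod_two_cases j with rfl | rfl
  · exact absurd rfl hij
  · simpa [proj] using Submodule.projection_apply_right S.isCompl.symm ⟨x, hx⟩
  · simpa [proj] using Submodule.projection_apply_right S.isCompl ⟨x, hx⟩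
  · exact absurd rfl hij

/-- The operator `v ↦ (-1)^{i|v|} v` on a super space. -/
def signOp (S : SuperSpace V) (i : ZMod 2) : V →ₗ[ℂ] V :=
  S.proj 0 + superSign i 1 • S.proj 1

theorem signOp_apply (S : SuperSpace V) (i : ZMod 2) {j : ZMod 2} {x : V}
    (hx : x ∈ S.part j) : S.signOp i x = superSign i j • x := by
  rcases zmod_two_cases j with rfl | rfl
  · simp [signOp, proj_self S hx, proj_of_ne S zero_ne_one hx]
  · simp [signOp, proj_self S hx, proj_of_ne S one_ne_zero hx]

/-- The grading of a tensor product: `(V ⊗ W)_k` is spanned by the tensors `v ⊗ w` of homogeneous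
elements with `|v| + |w| = k`. -/
def tensorPart (S : SuperSpace V) (T : SuperSpace W) (k : ZMod 2) : Submodule ℂ (V ⊗[ℂ] W) :=
  Submodule.span ℂ {t | ∃ i j : ZMod 2, i + j = k ∧
    ∃ v ∈ S.part i, ∃ w ∈ T.part j, v ⊗ₜ[ℂ] w = t}

theorem tmul_mem_tensorPart (S : SuperSpace V) (T : SuperSpace W) {i j k : ZMod 2}
    (h : i + j = k) {v : V} (hv : v ∈ S.part i) {w : W} (hw : w ∈ T.part j) :
    v ⊗ₜ[ℂ] w ∈ tensorPart S T k :=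
  Submodule.subset_span ⟨i, j, h, v, hv, w, hw, rfl⟩

theorem mem_tensorPart_sup (S : SuperSpace V) (T : SuperSpace W) (t : V ⊗[ℂ] W) :
    t ∈ tensorPart S T 0 ⊔ tensorPart S T 1 := by
  induction t with
  | zero => exact Submodule.zero_mem _
  | add x y hx hy => exact Submodule.add_mem _ hx hy
  | tmul v w =>
    have key : ∀ i j : ZMod 2, S.proj i v ⊗ₜ[ℂ] T.proj j w ∈
        tensorPart S T 0 ⊔ tensorPart S T 1 := by
      intro i j
      rcases zmod_two_cases (i + j) with h | h
      · exact Submodule.mem_sup_left (tmul_mem_tensorPart S T h (S.proj_mem i v) (T.proj_mem j w))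
      · exact Submodule.mem_sup_right (tmul_mem_tensorPart S T h (S.proj_mem i v) (T.proj_mem j w))
    rw [← S.proj_zero_add_proj_one v, ← T.proj_zero_add_proj_one w, TensorProduct.add_tmul,
      TensorProduct.tmul_add, TensorProduct.tmul_add]
    exact Submodule.add_mem _ (Submodule.add_mem _ (key 0 0) (key 0 1))
      (Submodule.add_mem _ (key 1 0) (key 1 1))

theorem parity_tensorPart (S : SuperSpace V) (T : SuperSpace W) {k : ZMod 2} {t : V ⊗[ℂ] W}
    (ht : t ∈ tensorPart S T k) :
    TensorProduct.map (S.signOp 1) (T.signOp 1) t = superSign 1 k • t := by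
  induction ht using Submodule.span_induction with
  | zero => simp
  | add x y _ _ hx hy => rw [map_add, hx, hy, smul_add]
  | smul a x _ hx => rw [map_smul, hx, smul_comm]
  | mem x hx =>
    obtain ⟨i, j, rfl, v, hv, w, hw, rfl⟩ := hx
    rw [TensorProduct.map_tmul, S.signOp_apply 1 hv, T.signOp_apply 1 hw]
    rcases zmod_two_cases i with rfl | rfl <;> rcases zmod_two_cases j with rfl | rfl <;>
      simp [zmod_two_one_add_one, TensorProduct.neg_tmul, TensorProduct.tmul_neg]

/-- The tensor product of two super spaces. -/
def tensor (S : SuperSpace V) (T : SuperSpace W) : SuperSpace (V ⊗[ℂ] W) where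
  part := tensorPart S T
  isCompl := isCompl_of_parity (TensorProduct.map (S.signOp 1) (T.signOp 1))
    (fun x hx => by simpa using parity_tensorPart S T hx)
    (fun x hx => by simpa using parity_tensorPart S T hx)
    (mem_tensorPart_sup S T)

/-- A vector space placed in even degree. -/
def purelyEven (V : Type*) [AddCommGroup V] [Module ℂ V] : SuperSpace V where
  part i := if i = 0 then ⊤ else ⊥
  isCompl := by simpa using isCompl_top_bot

end SuperSpace

/-! ### Lie superalgebras -/

/-- A complex Lie superalgebra. -/
class LieSuperalgebra (L : Type*) [AddCommGroup L] [Module ℂ L] where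
  space : SuperSpace L
  bracket : L →ₗ[ℂ] L →ₗ[ℂ] L
  bracket_mem : ∀ {i j : ZMod 2} {x y : L}, x ∈ space.part i → y ∈ space.part j →
    bracket x y ∈ space.part (i + j)
  bracket_skew : ∀ {i j : ZMod 2} {x y : L}, x ∈ space.part i → y ∈ space.part j →
    bracket x y = -(superSign i j • bracket y x)
  bracket_jacobi : ∀ {i j k : ZMod 2} {x y z : L}, x ∈ space.part i → y ∈ space.part j →
    z ∈ space.part k →
    bracket x (bracket y z) = bracket (bracket x y) z + superSign i j • bracket y (bracket x z)

/-- The component of degree `i` of a Lie superalgebra. -/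
abbrev LieSuperalgebra.part (L : Type*) [AddCommGroup L] [Module ℂ L] [LieSuperalgebra L]
    (i : ZMod 2) : Submodule ℂ L :=
  (LieSuperalgebra.space (L := L)).part i

/-- A homomorphism of Lie superalgebras: an even linear map that preserves brackets. -/
structure LieSuperHom (L L' : Type*) [AddCommGroup L] [Module ℂ L] [LieSuperalgebra L]
    [AddCommGroup L'] [Module ℂ L'] [LieSuperalgebra L'] where
  toLinearMap : L →ₗ[ℂ] L'
  map_mem : ∀ {i : ZMod 2} {x : L}, x ∈ LieSuperalgebra.part L i →
    toLinearMap x ∈ LieSuperalgebra.part L' i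
  map_bracket : ∀ x y : L, toLinearMap (LieSuperalgebra.bracket x y) =
    LieSuperalgebra.bracket (toLinearMap x) (toLinearMap y)

/-! ### The general linear and the periplectic Lie superalgebras -/

section Matrices

variable {ι κ : Type*}

/-- The component of degree `i` of a block matrix: its diagonal blocks for `i = 0`, its
off-diagonal blocks for `i = 1`. -/
def blockPart (i : ZMod 2) : Matrix (ι ⊕ κ) (ι ⊕ κ) ℂ →ₗ[ℂ] Matrix (ι ⊕ κ) (ι ⊕ κ) ℂ where
  toFun M := if i = 0 then Matrix.fromBlocks M.toBlocks₁₁ 0 0 M.toBlocks₂₂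
    else Matrix.fromBlocks 0 M.toBlocks₁₂ M.toBlocks₂₁ 0
  map_add' M N := by
    split_ifs <;> ext (a | a) (b | b) <;>
      simp [Matrix.toBlocks₁₁, Matrix.toBlocks₁₂, Matrix.toBlocks₂₁, Matrix.toBlocks₂₂]
  map_smul' c M := by
    split_ifs <;> ext (a | a) (b | b) <;>
      simp [Matrix.toBlocks₁₁, Matrix.toBlocks₁₂, Matrix.toBlocks₂₁, Matrix.toBlocks₂₂]

theorem blockPart_zero_add_one (M : Matrix (ι ⊕ κ) (ι ⊕ κ) ℂ) :
    blockPart 0 M + blockPart 1 M = M := by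
  ext (a | a) (b | b) <;>
    simp [blockPart, Matrix.toBlocks₁₁, Matrix.toBlocks₁₂, Matrix.toBlocks₂₁, Matrix.toBlocks₂₂]

theorem blockPart_blockPart (i j : ZMod 2) (M : Matrix (ι ⊕ κ) (ι ⊕ κ) ℂ) :
    blockPart i (blockPart j M) = if i = j then blockPart j M else 0 := by
  rcases zmod_two_cases i with rfl | rfl <;> rcases zmod_two_cases j with rfl | rfl <;>
    simp [blockPart]

/-- The standard super space structure on block matrices: block diagonal matrices are even, block
off-diagonal matrices are odd. -/
def matrixSuperSpace : SuperSpace (Matrix (ι ⊕ κ) (ι ⊕ κ) ℂ) where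
  part i := LinearMap.range (blockPart (ι := ι) (κ := κ) i)
  isCompl := isCompl_of_parity (blockPart 0 - blockPart 1)
    (by rintro _ ⟨M, rfl⟩; simp [blockPart_blockPart])
    (by rintro _ ⟨M, rfl⟩; simp [blockPart_blockPart])
    (fun M => by
      rw [← blockPart_zero_add_one M]
      exact Submodule.add_mem_sup ⟨M, rfl⟩ ⟨M, rfl⟩)

theorem blockPart_of_mem {i j : ZMod 2} {M : Matrix (ι ⊕ κ) (ι ⊕ κ) ℂ}
    (hM : M ∈ matrixSuperSpace.part i) : blockPart j M = if j = i then M else 0 := by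
  obtain ⟨N, rfl⟩ := hM
  exact blockPart_blockPart j i N

variable [Fintype ι] [Fintype κ]

theorem mul_mem_matrixPart {i j : ZMod 2} {M N : Matrix (ι ⊕ κ) (ι ⊕ κ) ℂ}
    (hM : M ∈ matrixSuperSpace.part i) (hN : N ∈ matrixSuperSpace.part j) :
    M * N ∈ matrixSuperSpace.part (i + j) := by
  obtain ⟨M, rfl⟩ := hM
  obtain ⟨N, rfl⟩ := hN
  refine ⟨blockPart i M * blockPart j N, ?_⟩
  rcases zmod_two_cases i with rfl | rfl <;> rcases zmod_two_cases j with rfl | rfl <;>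
    simp [blockPart, Matrix.fromBlocks_multiply, zmod_two_one_add_one]

/-- The supercommutator on block matrices: the bilinear extension of
`[M, N] = M N - (-1)^{|M||N|} N M`. -/
def superCommutator : Matrix (ι ⊕ κ) (ι ⊕ κ) ℂ →ₗ[ℂ] Matrix (ι ⊕ κ) (ι ⊕ κ) ℂ →ₗ[ℂ]
    Matrix (ι ⊕ κ) (ι ⊕ κ) ℂ :=
  LinearMap.mk₂ ℂ
    (fun M N => M * N - (blockPart 0 N * M + blockPart 1 N * (blockPart 0 M - blockPart 1 M)))
    (fun M M' N => by simp only [map_add]; noncomm_ring)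
    (fun c M N => by simp only [map_smul, Matrix.smul_mul, Matrix.mul_smul, ← smul_sub, ← smul_add])
    (fun M N N' => by simp only [map_add]; noncomm_ring)
    (fun c M N => by simp only [map_smul, Matrix.smul_mul, Matrix.mul_smul, ← smul_sub, ← smul_add])

theorem superCommutator_apply {i j : ZMod 2} {M N : Matrix (ι ⊕ κ) (ι ⊕ κ) ℂ}
    (hM : M ∈ matrixSuperSpace.part i) (hN : N ∈ matrixSuperSpace.part j) :
    superCommutator M N = M * N - superSign i j • (N * M) := by
  simp only [superCommutator, LinearMap.mk₂_apply, blockPart_of_mem hM, blockPart_of_mem hN]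
  rcases zmod_two_cases i with rfl | rfl <;> rcases zmod_two_cases j with rfl | rfl <;> simp

theorem superCommutator_mem {i j : ZMod 2} {M N : Matrix (ι ⊕ κ) (ι ⊕ κ) ℂ}
    (hM : M ∈ matrixSuperSpace.part i) (hN : N ∈ matrixSuperSpace.part j) :
    superCommutator M N ∈ matrixSuperSpace.part (i + j) := by
  rw [superCommutator_apply hM hN]
  exact Submodule.sub_mem _ (mul_mem_matrixPart hM hN)
    (Submodule.smul_mem _ _ (by rw [add_comm]; exact mul_mem_matrixPart hN hM))

/-- The general linear Lie superalgebra `gl(ι|κ)`. -/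
instance generalLinear : LieSuperalgebra (Matrix (ι ⊕ κ) (ι ⊕ κ) ℂ) where
  space := matrixSuperSpace
  bracket := superCommutator
  bracket_mem := superCommutator_mem
  bracket_skew {i j x y} hx hy := by
    rw [superCommutator_apply hx hy, superCommutator_apply hy hx]
    rcases zmod_two_cases i with rfl | rfl <;> rcases zmod_two_cases j with rfl | rfl <;>
      simp [add_comm]
  bracket_jacobi {i j k x y z} hx hy hz := by
    rw [superCommutator_apply hx (superCommutator_mem hy hz),
      superCommutator_apply (superCommutator_mem hx hy) hz,
      superCommutator_apply hy (superCommutator_mem hx hz),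
      superCommutator_apply hx hy, superCommutator_apply hx hz, superCommutator_apply hy hz]
    rcases zmod_two_cases i with rfl | rfl <;> rcases zmod_two_cases j with rfl | rfl <;>
      rcases zmod_two_cases k with rfl | rfl <;>
      simp [zmod_two_one_add_one] <;> noncomm_ring

end Matrices

/-- The underlying space of the periplectic Lie superalgebra `p(n) ⊆ gl(n+1|n+1)`: the block
matrices `(X Y; Z -Xᵀ)` with `X` traceless, `Y` symmetric and `Z` skew-symmetric. -/
def periplectic (n : ℕ) :
    Submodule ℂ (Matrix (Fin (n + 1) ⊕ Fin (n + 1)) (Fin (n + 1) ⊕ Fin (n + 1)) ℂ) where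
  carrier := {M | ∃ X Y Z : Matrix (Fin (n + 1)) (Fin (n + 1)) ℂ,
    X.trace = 0 ∧ Y.transpose = Y ∧ Z.transpose = -Z ∧
      M = Matrix.fromBlocks X Y Z (-X.transpose)}
  zero_mem' := ⟨0, 0, 0, by simp, by simp, by simp, by simp⟩
  add_mem' := by
    rintro _ _ ⟨X, Y, Z, hX, hY, hZ, rfl⟩ ⟨X', Y', Z', hX', hY', hZ', rfl⟩
    refine ⟨X + X', Y + Y', Z + Z', by simp [hX, hX'], by simp [hY, hY'],
      by simp [hZ, hZ', add_comm], ?_⟩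
    rw [Matrix.fromBlocks_add, Matrix.transpose_add, neg_add]
  smul_mem' := by
    rintro c _ ⟨X, Y, Z, hX, hY, hZ, rfl⟩
    refine ⟨c • X, c • Y, c • Z, by simp [hX], by simp [hY], by simp [hZ], ?_⟩
    rw [Matrix.fromBlocks_smul, Matrix.transpose_smul, smul_neg]

theorem blockPart_mem_periplectic {n : ℕ} (i : ZMod 2)
    {M : Matrix (Fin (n + 1) ⊕ Fin (n + 1)) (Fin (n + 1) ⊕ Fin (n + 1)) ℂ}
    (hM : M ∈ periplectic n) : blockPart i M ∈ periplectic n := by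
  obtain ⟨X, Y, Z, hX, hY, hZ, rfl⟩ := hM
  rcases zmod_two_cases i with rfl | rfl
  · exact ⟨X, 0, 0, hX, by simp, by simp, by simp [blockPart]⟩
  · exact ⟨0, Y, Z, by simp, hY, hZ, by simp [blockPart]⟩

theorem superCommutator_mem_periplectic {n : ℕ}
    {M N : Matrix (Fin (n + 1) ⊕ Fin (n + 1)) (Fin (n + 1) ⊕ Fin (n + 1)) ℂ}
    (hM : M ∈ periplectic n) (hN : N ∈ periplectic n) :
    superCommutator M N ∈ periplectic n := by
  obtain ⟨X, Y, Z, hX, hY, hZ, rfl⟩ := hM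
  obtain ⟨X', Y', Z', hX', hY', hZ', rfl⟩ := hN
  have tr : ∀ P Q : Matrix (Fin (n + 1)) (Fin (n + 1)) ℂ, P.transpose = P → Q.transpose = -Q →
      (P * Q).trace = 0 := by
    intro P Q hP hQ
    have h : (P * Q).trace = -(P * Q).trace := by
      conv_lhs => rw [← Matrix.trace_transpose, Matrix.transpose_mul, hP, hQ, neg_mul,
        Matrix.trace_neg, Matrix.trace_mul_comm]
    exact self_eq_neg.mp h
  refine ⟨X * X' - X' * X + (Y * Z' + Y' * Z),
    X * Y' + Y' * X.transpose - (X' * Y + Y * X'.transpose),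
    Z * X' + X'.transpose * Z - (Z' * X + X.transpose * Z'), ?_, ?_, ?_, ?_⟩
  · rw [Matrix.trace_add, Matrix.trace_sub, Matrix.trace_add, tr _ _ hY hZ', tr _ _ hY' hZ,
      Matrix.trace_mul_comm X X']
    simp
  · simp only [Matrix.transpose_sub, Matrix.transpose_add, Matrix.transpose_mul,
      Matrix.transpose_transpose, hY, hY']
    abel
  · simp only [Matrix.transpose_sub, Matrix.transpose_add, Matrix.transpose_mul,
      Matrix.transpose_transpose, hZ, hZ', neg_mul, mul_neg]
    abel
  · simp only [superCommutator, LinearMap.mk₂_apply, blockPart, LinearMap.coe_mk, AddHom.coe_mk,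
      Matrix.toBlocks_fromBlocks₁₁, Matrix.toBlocks_fromBlocks₁₂, Matrix.toBlocks_fromBlocks₂₁,
      Matrix.toBlocks_fromBlocks₂₂, if_true, one_ne_zero, if_false, sub_eq_add_neg,
      Matrix.fromBlocks_neg, Matrix.fromBlocks_add, Matrix.fromBlocks_multiply,
      Matrix.transpose_add, Matrix.transpose_neg, Matrix.transpose_mul, hY, hY', hZ, hZ']
    congr 1 <;> noncomm_ring

/-- The super space structure on `p(n)` inherited from `gl(n+1|n+1)`. -/
def periplecticSuperSpace (n : ℕ) : SuperSpace (periplectic n) where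
  part i := (matrixSuperSpace.part i).comap (periplectic n).subtype
  isCompl := by
    refine ⟨?_, ?_⟩
    · rw [Submodule.disjoint_def]
      intro x h0 h1
      exact Subtype.ext ((Submodule.disjoint_def.mp matrixSuperSpace.isCompl.disjoint) _ h0 h1)
    · rw [codisjoint_iff, eq_top_iff]
      intro x _
      have hx : x = ⟨blockPart 0 x.1, blockPart_mem_periplectic 0 x.2⟩ +
          ⟨blockPart 1 x.1, blockPart_mem_periplectic 1 x.2⟩ :=
        Subtype.ext (blockPart_zero_add_one x.1).symm
      rw [hx]
      exact Submodule.add_mem_sup ⟨x.1, rfl⟩ ⟨x.1, rfl⟩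

/-- The periplectic Lie superalgebra `p(n)`, a Lie subsuperalgebra of `gl(n+1|n+1)`. -/
instance periplecticLieSuperalgebra (n : ℕ) : LieSuperalgebra (periplectic n) where
  space := periplecticSuperSpace n
  bracket := LinearMap.mk₂ ℂ
    (fun x y => ⟨superCommutator x.1 y.1, superCommutator_mem_periplectic x.2 y.2⟩)
    (fun x y z => Subtype.ext (by simp))
    (fun c x y => Subtype.ext (by simp))
    (fun x y z => Subtype.ext (by simp))
    (fun c x y => Subtype.ext (by simp))
  bracket_mem hx hy := superCommutator_mem hx hy
  bracket_skew hx hy := Subtype.ext (generalLinear.bracket_skew hx hy)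
  bracket_jacobi hx hy hz := Subtype.ext (generalLinear.bracket_jacobi hx hy hz)

/-! ### Map superalgebras -/

section MapSuperalgebra

variable (L : Type*) [AddCommGroup L] [Module ℂ L] [LieSuperalgebra L]
  (A : Type*) [CommRing A] [Algebra ℂ A]

/-- The bracket `[x ⊗ a, y ⊗ b] = [x, y] ⊗ ab` on `L ⊗ A`. -/
def mapBracket : L ⊗[ℂ] A →ₗ[ℂ] L ⊗[ℂ] A →ₗ[ℂ] L ⊗[ℂ] A :=
  TensorProduct.map₂ LieSuperalgebra.bracket (LinearMap.mul ℂ A)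

theorem mapBracket_tmul (x y : L) (a b : A) :
    mapBracket L A (x ⊗ₜ a) (y ⊗ₜ b) = LieSuperalgebra.bracket x y ⊗ₜ (a * b) := rfl

/-- The component `(L ⊗ A)_i = L_i ⊗ A`, spanned by the `x ⊗ a` with `x ∈ L_i`. -/
def mapPart (i : ZMod 2) : Submodule ℂ (L ⊗[ℂ] A) :=
  Submodule.span ℂ {t | ∃ x ∈ LieSuperalgebra.part L i, ∃ a : A, x ⊗ₜ[ℂ] a = t}

/-- The super space structure on `L ⊗ A`. -/
def mapSuperSpace : SuperSpace (L ⊗[ℂ] A) where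
  part := mapPart L A
  isCompl := by
    have key : ∀ (k : ZMod 2) (t : L ⊗[ℂ] A), t ∈ mapPart L A k →
        TensorProduct.map ((LieSuperalgebra.space (L := L)).signOp 1) LinearMap.id t =
          superSign 1 k • t := by
      intro k t ht
      induction ht using Submodule.span_induction with
      | zero => simp
      | add x y _ _ hx hy => rw [map_add, hx, hy, smul_add]
      | smul a x _ hx => rw [map_smul, hx, smul_comm]
      | mem x hx =>
        obtain ⟨x, hx, a, rfl⟩ := hx
        rw [TensorProduct.map_tmul, SuperSpace.signOp_apply _ 1 hx, TensorProduct.smul_tmul',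
          LinearMap.id_apply]
    refine isCompl_of_parity _ (fun x hx => by simpa using key 0 x hx)
      (fun x hx => by simpa using key 1 x hx) (fun t => ?_)
    induction t with
    | zero => exact Submodule.zero_mem _
    | add x y hx hy => exact Submodule.add_mem _ hx hy
    | tmul x a =>
      rw [← (LieSuperalgebra.space (L := L)).proj_zero_add_proj_one x, TensorProduct.add_tmul]
      exact Submodule.add_mem_sup
        (Submodule.subset_span ⟨_, SuperSpace.proj_mem _ 0 x, a, rfl⟩)
        (Submodule.subset_span ⟨_, SuperSpace.proj_mem _ 1 x, a, rfl⟩)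

/-- The map superalgebra `L ⊗ A`. -/
instance mapSuperalgebra : LieSuperalgebra (L ⊗[ℂ] A) where
  space := mapSuperSpace L A
  bracket := mapBracket L A
  bracket_mem {i j x y} hx hy := by
    change x ∈ mapPart L A i at hx
    change y ∈ mapPart L A j at hy
    change _ ∈ mapPart L A (i + j)
    induction hx, hy using Submodule.span_induction₂ with
    | mem_mem x y hx hy =>
      obtain ⟨x, hx, a, rfl⟩ := hx
      obtain ⟨y, hy, b, rfl⟩ := hy
      exact Submodule.subset_span ⟨_, LieSuperalgebra.bracket_mem hx hy, a * b, rfl⟩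
    | zero_left y hy => simp
    | zero_right x hx => simp
    | add_left x y z _ _ _ h1 h2 => simpa using Submodule.add_mem _ h1 h2
    | add_right x y z _ _ _ h1 h2 => simpa using Submodule.add_mem _ h1 h2
    | smul_left r x y _ _ h => simpa using Submodule.smul_mem _ r h
    | smul_right r x y _ _ h => simpa using Submodule.smul_mem _ r h
  bracket_skew {i j x y} hx hy := by
    change x ∈ mapPart L A i at hx
    change y ∈ mapPart L A j at hy
    induction hx, hy using Submodule.span_induction₂ with
    | mem_mem x y hx hy =>
      obtain ⟨x, hx, a, rfl⟩ := hx
      obtain ⟨y, hy, b, rfl⟩ := hy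
      rw [mapBracket_tmul, mapBracket_tmul, LieSuperalgebra.bracket_skew hx hy,
        TensorProduct.neg_tmul, TensorProduct.smul_tmul', mul_comm a b]
    | zero_left y hy => simp
    | zero_right x hx => simp
    | add_left x y z _ _ _ h1 h2 => simp only [map_add, LinearMap.add_apply, h1, h2]; module
    | add_right x y z _ _ _ h1 h2 => simp only [map_add, LinearMap.add_apply, h1, h2]; module
    | smul_left r x y _ _ h => simp only [map_smul, LinearMap.smul_apply, h]; module
    | smul_right r x y _ _ h => simp only [map_smul, LinearMap.smul_apply, h]; module
  bracket_jacobi {i j k x y z} hx hy hz := by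
    change x ∈ mapPart L A i at hx
    change y ∈ mapPart L A j at hy
    change z ∈ mapPart L A k at hz
    induction hx, hy using Submodule.span_induction₂ with
    | mem_mem x y hx hy =>
      obtain ⟨x, hx, a, rfl⟩ := hx
      obtain ⟨y, hy, b, rfl⟩ := hy
      induction hz using Submodule.span_induction with
      | zero => simp
      | add z w _ _ h1 h2 => simp only [map_add, h1, h2]; module
      | smul r z _ h => simp only [map_smul, h]; module
      | mem z hz =>
        obtain ⟨z, hz, c, rfl⟩ := hz
        simp only [mapBracket_tmul]
        rw [LieSuperalgebra.bracket_jacobi hx hy hz, TensorProduct.add_tmul,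
          TensorProduct.smul_tmul', mul_assoc, mul_left_comm b a c]
    | zero_left y hy => simp
    | zero_right x hx => simp
    | add_left x y z _ _ _ h1 h2 => simp only [map_add, LinearMap.add_apply, h1, h2]; module
    | add_right x y z _ _ _ h1 h2 => simp only [map_add, LinearMap.add_apply, h1, h2]; module
    | smul_left r x y _ _ h => simp only [map_smul, LinearMap.smul_apply, h]; module
    | smul_right r x y _ _ h => simp only [map_smul, LinearMap.smul_apply, h]; module

end MapSuperalgebra

/-! ### Modules over Lie superalgebras -/

/-- A module over a Lie superalgebra `L`: a super space with an even linear action of `L` such that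
`[x, y] v = x (y v) - (-1)^{|x||y|} y (x v)` for homogeneous `x`, `y`. -/
structure SuperModule (L : Type*) [AddCommGroup L] [Module ℂ L] [LieSuperalgebra L] where
  carrier : Type v
  [addCommGroup : AddCommGroup carrier]
  [module : Module ℂ carrier]
  space : SuperSpace carrier
  action : L →ₗ[ℂ] Module.End ℂ carrier
  action_mem : ∀ {i j : ZMod 2} {x : L} {w : carrier}, x ∈ LieSuperalgebra.part L i →
    w ∈ space.part j → action x w ∈ space.part (i + j)
  action_bracket : ∀ {i j : ZMod 2} {x y : L}, x ∈ LieSuperalgebra.part L i →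
    y ∈ LieSuperalgebra.part L j → ∀ w : carrier,
    action (LieSuperalgebra.bracket x y) w =
      action x (action y w) - superSign i j • action y (action x w)

namespace SuperModule

attribute [instance] SuperModule.addCommGroup SuperModule.module

variable {L : Type*} [AddCommGroup L] [Module ℂ L] [LieSuperalgebra L]
  {L' : Type*} [AddCommGroup L'] [Module ℂ L'] [LieSuperalgebra L']

/-- A subspace of `V` is a submodule if it is a graded subspace, `N = (N ∩ V₀) + (N ∩ V₁)`, and
is stable under the action. -/
def IsSubmodule (V : SuperModule.{v} L) (N : Submodule ℂ V.carrier) : Prop :=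
  N ≤ (N ⊓ V.space.part 0) ⊔ (N ⊓ V.space.part 1) ∧
    ∀ (x : L), ∀ w ∈ N, V.action x w ∈ N

/-- A module is irreducible if it is nonzero and has no submodules but `0` and itself. -/
def IsIrreducible (V : SuperModule.{v} L) : Prop :=
  Nontrivial V.carrier ∧ ∀ N : Submodule ℂ V.carrier, V.IsSubmodule N → N = ⊥ ∨ N = ⊤

/-- Isomorphisms of modules: bijective linear maps that preserve the grading and commute with the
action. -/
structure Iso (V W : SuperModule.{v} L) where
  toLinearEquiv : V.carrier ≃ₗ[ℂ] W.carrier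
  map_mem : ∀ {i : ZMod 2} {w : V.carrier}, w ∈ V.space.part i →
    toLinearEquiv w ∈ W.space.part i
  map_action : ∀ (x : L) (w : V.carrier),
    toLinearEquiv (V.action x w) = W.action x (toLinearEquiv w)

/-- The pull-back of a module along a homomorphism of Lie superalgebras. -/
def pullback (f : LieSuperHom L' L) (V : SuperModule.{v} L) : SuperModule.{v} L' where
  carrier := V.carrier
  space := V.space
  action := V.action ∘ₗ f.toLinearMap
  action_mem hx hw := V.action_mem (f.map_mem hx) hw
  action_bracket {i j x y} hx hy w := by
    simp only [LinearMap.comp_apply, f.map_bracket]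
    exact V.action_bracket (f.map_mem hx) (f.map_mem hy) w

variable (L) in
/-- The trivial one-dimensional module `ℂ`, in even degree. -/
def trivial : SuperModule.{v} L where
  carrier := ULift.{v} ℂ
  space := SuperSpace.purelyEven _
  action := 0
  action_mem _ _ := Submodule.zero_mem _
  action_bracket _ _ _ := by simp

/-- The action of `L` on `V ⊗ W`, the bilinear extension of
`x (v ⊗ w) = x v ⊗ w + (-1)^{|x||v|} v ⊗ x w`. -/
def tensorAction (V W : SuperModule.{v} L) :
    L →ₗ[ℂ] Module.End ℂ (V.carrier ⊗[ℂ] W.carrier) :=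
  (TensorProduct.mapBilinear (RingHom.id ℂ) V.carrier W.carrier V.carrier W.carrier).flip
      LinearMap.id ∘ₗ V.action +
    TensorProduct.mapBilinear (RingHom.id ℂ) V.carrier W.carrier V.carrier W.carrier
      (V.space.signOp 0) ∘ₗ W.action ∘ₗ (LieSuperalgebra.space (L := L)).proj 0 +
    TensorProduct.mapBilinear (RingHom.id ℂ) V.carrier W.carrier V.carrier W.carrier
      (V.space.signOp 1) ∘ₗ W.action ∘ₗ (LieSuperalgebra.space (L := L)).proj 1

theorem tensorAction_tmul (V W : SuperModule.{v} L) {i j : ZMod 2} {x : L} {a : V.carrier}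
    (hx : x ∈ LieSuperalgebra.part L i) (ha : a ∈ V.space.part j) (b : W.carrier) :
    tensorAction V W x (a ⊗ₜ[ℂ] b) =
      V.action x a ⊗ₜ[ℂ] b + superSign i j • (a ⊗ₜ[ℂ] W.action x b) := by
  simp only [tensorAction, LinearMap.add_apply, LinearMap.comp_apply, LinearMap.flip_apply,
    TensorProduct.mapBilinear_apply, TensorProduct.map_tmul, LinearMap.id_apply,
    V.space.signOp_apply _ ha]
  rcases zmod_two_cases i with rfl | rfl
  · rw [SuperSpace.proj_self _ hx, SuperSpace.proj_of_ne _ zero_ne_one hx]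
    simp
  · rw [SuperSpace.proj_self _ hx, SuperSpace.proj_of_ne _ one_ne_zero hx]
    simp [TensorProduct.smul_tmul']

/-- The tensor product of two modules. -/
def tensor (V W : SuperModule.{v} L) : SuperModule.{v} L where
  carrier := V.carrier ⊗[ℂ] W.carrier
  space := V.space.tensor W.space
  action := tensorAction V W
  action_mem {i j x t} hx ht := by
    change t ∈ SuperSpace.tensorPart V.space W.space j at ht
    change _ ∈ SuperSpace.tensorPart V.space W.space (i + j)
    induction ht using Submodule.span_induction with
    | zero => simp
    | add s t _ _ h1 h2 => simpa using Submodule.add_mem _ h1 h2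
    | smul r t _ h => simpa using Submodule.smul_mem _ r h
    | mem t ht =>
      obtain ⟨k, l, rfl, a, ha, b, hb, rfl⟩ := ht
      rw [tensorAction_tmul V W hx ha]
      exact Submodule.add_mem _
        (SuperSpace.tmul_mem_tensorPart _ _ (add_assoc i k l) (V.action_mem hx ha) hb)
        (Submodule.smul_mem _ _ (SuperSpace.tmul_mem_tensorPart _ _ (add_left_comm k i l) ha
          (W.action_mem hx hb)))
  action_bracket {i j x y} hx hy t := by
    induction t with
    | zero => simp
    | add s t h1 h2 => simp only [map_add, h1, h2]; module
    | tmul a b =>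
      have key : ∀ (k : ZMod 2) (a : V.carrier), a ∈ V.space.part k →
          tensorAction V W (LieSuperalgebra.bracket x y) (a ⊗ₜ[ℂ] b) =
            tensorAction V W x (tensorAction V W y (a ⊗ₜ[ℂ] b)) -
              superSign i j • tensorAction V W y (tensorAction V W x (a ⊗ₜ[ℂ] b)) := by
        intro k a ha
        rw [tensorAction_tmul V W (LieSuperalgebra.bracket_mem hx hy) ha,
          tensorAction_tmul V W hx ha, tensorAction_tmul V W hy ha, map_add, map_add, map_smul,
          map_smul, tensorAction_tmul V W hx ha, tensorAction_tmul V W hy ha,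
          tensorAction_tmul V W hx (V.action_mem hy ha),
          tensorAction_tmul V W hy (V.action_mem hx ha),
          V.action_bracket hx hy, W.action_bracket hx hy]
        rcases zmod_two_cases i with rfl | rfl <;> rcases zmod_two_cases j with rfl | rfl <;>
          rcases zmod_two_cases k with rfl | rfl <;>
          simp [zmod_two_one_add_one, TensorProduct.sub_tmul, TensorProduct.tmul_sub,
            TensorProduct.add_tmul, TensorProduct.tmul_add] <;> abel
      rw [← V.space.proj_zero_add_proj_one a, TensorProduct.add_tmul]
      simp only [map_add, key _ _ (V.space.proj_mem 0 a), key _ _ (V.space.proj_mem 1 a)]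
      module

/-- The tensor product `V₀ ⊗ (V₁ ⊗ ( ⋯ ⊗ ℂ))` of a finite family of modules; the empty tensor
product is the trivial module `ℂ`. -/
def tensorFamily : (ℓ : ℕ) → (Fin ℓ → SuperModule.{v} L) → SuperModule.{v} L
  | 0, _ => trivial L
  | ℓ + 1, V => tensor (V 0) (tensorFamily ℓ fun i => V i.succ)

end SuperModule

/-! ### Evaluation modules -/

section Evaluation

variable {A : Type*} [CommRing A] [Algebra ℂ A] [Algebra.FiniteType ℂ A]

theorem algebraMap_residue_bijective (m : MaximalSpectrum A) :
    Function.Bijective (algebraMap ℂ (A ⧸ m.asIdeal)) := by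
  have := m.isMaximal
  let _ : Field (A ⧸ m.asIdeal) := Ideal.Quotient.field m.asIdeal
  have : Module.Finite ℂ (A ⧸ m.asIdeal) :=
    finite_of_finite_type_of_isJacobsonRing ℂ (A ⧸ m.asIdeal)
  exact IsAlgClosed.algebraMap_bijective_of_isIntegral

/-- The residue algebra `A / m` at a maximal ideal of a finitely generated algebra is `ℂ`. -/
def residueEquiv (m : MaximalSpectrum A) : (A ⧸ m.asIdeal) ≃ₐ[ℂ] ℂ :=
  (AlgEquiv.ofBijective (Algebra.ofId ℂ (A ⧸ m.asIdeal)) (algebraMap_residue_bijective m)).symm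

/-- The algebra homomorphism `A → A / m ≅ ℂ`. -/
def residueMap (m : MaximalSpectrum A) : A →ₐ[ℂ] ℂ :=
  (residueEquiv m).toAlgHom.comp (Ideal.Quotient.mkₐ ℂ m.asIdeal)

variable {L : Type*} [AddCommGroup L] [Module ℂ L] [LieSuperalgebra L]

variable (L) in
/-- The evaluation map `ev_m : L ⊗ A → L ⊗ A/m ≅ L ⊗ ℂ ≅ L`. -/
def evaluation (m : MaximalSpectrum A) : LieSuperHom (L ⊗[ℂ] A) L where
  toLinearMap := (TensorProduct.rid ℂ L).toLinearMap ∘ₗ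
    (residueMap m).toLinearMap.lTensor L
  map_mem {i t} ht := by
    change t ∈ mapPart L A i at ht
    induction ht using Submodule.span_induction with
    | zero => simp
    | add s t _ _ h1 h2 => simpa using Submodule.add_mem _ h1 h2
    | smul r t _ h => simpa using Submodule.smul_mem _ r h
    | mem t ht =>
      obtain ⟨x, hx, a, rfl⟩ := ht
      simpa using Submodule.smul_mem _ (residueMap m a) hx
  map_bracket s t := by
    induction s with
    | zero => simp
    | add s s' h1 h2 => simp only [map_add, LinearMap.add_apply, h1, h2]
    | tmul x a =>
      induction t with
      | zero => simp
      | add t t' h1 h2 => simp only [map_add, h1, h2]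
      | tmul y b =>
        change ((TensorProduct.rid ℂ L).toLinearMap ∘ₗ (residueMap m).toLinearMap.lTensor L)
          (LieSuperalgebra.bracket x y ⊗ₜ (a * b)) = _
        simp [mul_smul, smul_comm (residueMap m a)]

/-- The evaluation module `ev_m(V)`. -/
def evaluationModule (m : MaximalSpectrum A) (V : SuperModule.{v} L) :
    SuperModule.{v} (L ⊗[ℂ] A) :=
  V.pullback (evaluation L m)

end Evaluation

end

noncomputable section

/-! ### Linear algebra -/

section LinearAlgebra

variable {M : Type*} [AddCommGroup M] [Module ℂ M] [FiniteDimensional ℂ M]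

/-! Write `g` for the Lie superalgebra and let `I` be the set of all `a ∈ A` for which `g ⊗ a` acts
on `V` by zero. Every homogeneous component of `g` is spanned by brackets with even elements
(`periplectic_part_le_span`), so `I` is an ideal; it has finite codimension because `g` and `V` are
finite-dimensional.

The decisive point is that `I` is radical (`vanishingIdeal_isRadical`). If `a² ∈ I`, the operators
coming from `g ⊗ aA` supercommute. The odd ones square to zero. An even one `[y, z] ⊗ ab` is a
commutator that commutes with one of its entries, hence is nilpotent (`isNilpotent_of_commutator`).
Such operators have a common null vector, the common null space is a submodule, and irreducibility
makes it all of `V`, so that `a ∈ I`.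

Since `A` is a Jacobson ring, `I` contains a finite intersection of maximal ideals, and `V` becomes
a module over a finite direct sum of copies of `g`. A Chinese remainder idempotent writes the action
as the pull-back of a `g`-module structure plus a supercommuting action of the remaining copies. For
an irreducible `g`-submodule `W` of `V` the evaluation map `W ⊗ Hom_g(W, V) → V` is then an
isomorphism (`exists_tensor_factorization`): it is onto because `V` is irreducible, and injective by
Burnside's theorem. The second factor is again irreducible and involves one maximal ideal fewer, so
induction finishes the proof (`exists_iso_tensorFamily`).

Burnside's theorem needs `W` to stay irreducible when the grading is forgotten, which is false for
general superalgebras. Here it follows from highest weight theory (`IsIrreducible.ungraded`). There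
is an even `h` with integral diagonalizable adjoint action and even abelian centralizer, so an
irreducible module is generated by a homogeneous singular vector whose weight space is a line. A
singular vector of any stable subspace is therefore homogeneous. For `p(n)` one takes a traceless
diagonal matrix whose entries `±dᵢ` are pairwise distinct (`isRegular_periplecticElement`). -/

/-- A nonzero subspace with some property contains a minimal one. -/
theorem exists_minimal_submodule (P : Submodule ℂ M → Prop) {N : Submodule ℂ M}
    (hN : N ≠ ⊥) (hPN : P N) :
    ∃ W ≤ N, W ≠ ⊥ ∧ P W ∧ ∀ W' ≤ W, P W' → W' = ⊥ ∨ W' = W := by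
  obtain ⟨W, ⟨h1, h2, h3⟩, h4⟩ := (wellFounded_lt (α := Submodule ℂ M)).has_min
    {W | W ≤ N ∧ W ≠ ⊥ ∧ P W} ⟨N, le_rfl, hN, hPN⟩
  refine ⟨W, h1, h2, h3, fun W' hW' hP => ?_⟩
  by_contra! h
  exact h4 W' ⟨hW'.trans h1, h.1, hP⟩ (hW'.lt_of_ne h.2)

/-- Nilpotent operators that commute up to scalars have a common null vector. -/
theorem exists_common_null_vector [Nontrivial M] (S : Set (Module.End ℂ M))
    (hnil : ∀ s ∈ S, IsNilpotent s) (hcomm : ∀ s ∈ S, ∀ t ∈ S, ∃ c : ℂ, s * t = c • (t * s)) :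
    ∃ w : M, w ≠ 0 ∧ ∀ s ∈ S, s w = 0 := by
  obtain ⟨W, -, hW, hinv, hmin⟩ := exists_minimal_submodule
    (fun N : Submodule ℂ M => ∀ s ∈ S, ∀ w ∈ N, s w ∈ N) (N := ⊤) top_ne_bot (by simp)
  obtain ⟨w, hw, hw0⟩ := W.exists_mem_ne_zero_of_ne_bot hW
  refine ⟨w, hw0, fun s hs => ?_⟩
  -- Commuting up to a scalar already makes the kernel of `s` stable. By minimality `s` is then
  -- injective on `W`, which nilpotency forbids, or zero on `W`.
  have hker : ∀ t ∈ S, ∀ w ∈ W ⊓ LinearMap.ker s, t w ∈ W ⊓ LinearMap.ker s := by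
    intro t ht w hw
    refine ⟨hinv t ht w hw.1, ?_⟩
    obtain ⟨c, hc⟩ := hcomm s hs t ht
    have h0 : s w = 0 := hw.2
    have := LinearMap.congr_fun hc w
    simpa [h0] using this
  rcases hmin (W ⊓ LinearMap.ker s) inf_le_left hker with h | h
  · exfalso
    have hpow : ∀ k : ℕ, (s ^ k) w ∈ W := by
      intro k
      induction k with
      | zero => simpa
      | succ k ih => rw [pow_succ']; exact hinv s hs _ ih
    have hne : ∀ k : ℕ, (s ^ k) w ≠ 0 := by
      intro k
      induction k with
      | zero => simpa
      | succ k ih =>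
        rw [pow_succ']
        intro h0
        have : (s ^ k) w ∈ W ⊓ LinearMap.ker s := ⟨hpow k, h0⟩
        rw [h] at this
        exact ih this
    obtain ⟨k, hk⟩ := hnil s hs
    exact hne k (by simp [hk])
  · rw [← h] at hw
    exact hw.2

/-- Commuting operators have a common eigenvector. -/
theorem exists_common_eigenvector (S : Set (Module.End ℂ M)) {N : Submodule ℂ M} (hN : N ≠ ⊥)
    (hinv : ∀ s ∈ S, ∀ w ∈ N, s w ∈ N) (hcomm : ∀ s ∈ S, ∀ t ∈ S, ∀ w ∈ N, s (t w) = t (s w)) :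
    ∃ w ∈ N, w ≠ 0 ∧ ∀ s ∈ S, ∃ c : ℂ, s w = c • w := by
  obtain ⟨W, hWN, hW, hinv, hmin⟩ := exists_minimal_submodule
    (fun N : Submodule ℂ M => ∀ s ∈ S, ∀ w ∈ N, s w ∈ N) hN hinv
  obtain ⟨w, hw, hw0⟩ := W.exists_mem_ne_zero_of_ne_bot hW
  refine ⟨w, hWN hw, hw0, fun s hs => ?_⟩
  have : Nontrivial W := Submodule.nontrivial_iff_ne_bot.mpr hW
  obtain ⟨c, hc⟩ := Module.End.exists_eigenvalue (s.restrict (hinv s hs))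
  obtain ⟨e, he, he0⟩ := hc.exists_hasEigenvector
  have he' : s e = c • (e : M) := congrArg Subtype.val (Module.End.mem_eigenspace_iff.mp he)
  have heig : ∀ t ∈ S, ∀ w ∈ W ⊓ Module.End.eigenspace s c,
      t w ∈ W ⊓ Module.End.eigenspace s c := by
    intro t ht w hw
    refine ⟨hinv t ht w hw.1, Module.End.mem_eigenspace_iff.mpr ?_⟩
    rw [hcomm s hs t ht w (hWN hw.1), Module.End.mem_eigenspace_iff.mp hw.2, map_smul]
  rcases hmin (W ⊓ Module.End.eigenspace s c) inf_le_left heig with h | h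
  · exfalso
    have : (e : M) ∈ W ⊓ Module.End.eigenspace s c := ⟨e.2, Module.End.mem_eigenspace_iff.mpr he'⟩
    rw [h] at this
    exact he0 (Subtype.ext this)
  · rw [← h] at hw
    exact ⟨c, Module.End.mem_eigenspace_iff.mp hw.2⟩

/-- A commutator `y = [x, z]` that commutes with `z` is nilpotent. -/
theorem isNilpotent_of_commutator {x y z : Module.End ℂ M} (hy : y = x * z - z * x)
    (hyz : Commute y z) : IsNilpotent y := by
  -- Fitting decomposition by polynomials: the minimal polynomial is `X ^ k * g` with `X` and `g`
  -- coprime, and a Bézout identity for `X ^ (k + 1)` and `g` yields the idempotent `e` onto the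
  -- part where `y` is invertible.
  obtain ⟨g, hg, hnd⟩ := Polynomial.exists_eq_pow_rootMultiplicity_mul_and_not_dvd
    (minpoly ℂ y) (minpoly.ne_zero (Algebra.IsIntegral.isIntegral y)) 0
  set k := Polynomial.rootMultiplicity 0 (minpoly ℂ y)
  rw [map_zero, sub_zero] at hg hnd
  have hcop : IsCoprime ((Polynomial.X : Polynomial ℂ) ^ (k + 1)) g :=
    ((Polynomial.irreducible_X.coprime_iff_not_dvd).mpr hnd).pow_left
  obtain ⟨a, b, hab⟩ := hcop
  have hzero : y ^ k * Polynomial.aeval y g = 0 := by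
    have := minpoly.aeval ℂ y
    rw [hg] at this
    simpa using this
  have hone : Polynomial.aeval y a * y ^ (k + 1) + Polynomial.aeval y b * Polynomial.aeval y g = 1 := by
    simpa using congrArg (Polynomial.aeval y) hab
  set α := Polynomial.aeval y a
  set β := Polynomial.aeval y b
  set γ := Polynomial.aeval y g
  have hpoly : ∀ (p : Polynomial ℂ) (t : Module.End ℂ M), Commute y t →
      Commute (Polynomial.aeval y p) t := by
    intro p t ht
    induction p using Polynomial.induction_on' with
    | add p q hp hq => rw [map_add]; exact hp.add_left hq
    | monomial k c =>
      rw [Polynomial.aeval_monomial]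
      exact (Algebra.commute_algebraMap_left c t).mul_left (ht.pow_left k)
  have hcβ : Commute β y := hpoly b y (Commute.refl y)
  set e := α * y ^ (k + 1) with he
  have hyγ : y ^ (k + 1) * γ = 0 := by rw [pow_succ', mul_assoc, hzero, mul_zero]
  have hyβγ : y ^ (k + 1) * (β * γ) = 0 := by
    rw [← mul_assoc, ← (hcβ.pow_right (k + 1)).eq, mul_assoc, hyγ, mul_zero]
  have hidem : IsIdempotentElem e := by
    have : e * (e + β * γ) = e := by rw [hone, mul_one]
    rwa [mul_add, he, mul_assoc α _ (β * γ), hyβγ, mul_zero, add_zero, ← he] at this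
  have hzα : Commute α z := hpoly a z hyz
  -- Since `α` and `y ^ k` commute with `z`, they can be moved inside the commutator: `e = [α y ^ k
  -- x, z]`. An idempotent of trace zero vanishes in characteristic zero.
  have htr : LinearMap.trace ℂ M e = 0 := by
    have h1 : e = (α * y ^ k * x) * z - z * (α * y ^ k * x) := by
      have h2 : Commute z (α * y ^ k) := (hzα.mul_left (hyz.pow_left k)).symm
      have h3 : z * (α * y ^ k * x) = α * y ^ k * (z * x) := by
        rw [← mul_assoc, h2.eq, mul_assoc]
      rw [h3, mul_assoc (α * y ^ k) x z, ← mul_sub, ← hy, he, pow_succ, mul_assoc]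
    rw [h1, map_sub, LinearMap.trace_mul_comm, sub_self]
  have he0 : e = 0 := LinearMap.IsIdempotentElem.eq_zero_of_trace_eq_zero hidem htr
  refine ⟨k + 1, ?_⟩
  have : y ^ (k + 1) * (e + β * γ) = y ^ (k + 1) := by rw [hone, mul_one]
  rw [← this, mul_add, hyβγ, he0, mul_zero, add_zero]

/-- Burnside's theorem: operators without a common invariant subspace generate the full
endomorphism algebra. -/
theorem adjoin_eq_top_of_no_invariant_submodule [Nontrivial M] (S : Set (Module.End ℂ M))
    (hS : ∀ N : Submodule ℂ M, (∀ s ∈ S, ∀ w ∈ N, s w ∈ N) → N = ⊥ ∨ N = ⊤) :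
    Algebra.adjoin ℂ S = ⊤ := by
  let R := Algebra.adjoin ℂ S
  have hsimple : IsSimpleModule R M := by
    rw [isSimpleModule_iff]
    refine { exists_pair_ne := ⟨⊥, ⊤, bot_ne_top⟩, eq_bot_or_eq_top := fun N => ?_ }
    rcases hS (N.restrictScalars ℂ)
      (fun s hs w hw => N.smul_mem (⟨s, Algebra.subset_adjoin hs⟩ : R) hw) with h | h
    · exact Or.inl ((Submodule.restrictScalars_eq_bot_iff ℂ R M).mp h)
    · exact Or.inr ((Submodule.restrictScalars_eq_top_iff ℂ R M).mp h)
  -- Schur's lemma: an eigenspace of an `R`-endomorphism is invariant under `S`, hence everything.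
  have hschur : ∀ φ : Module.End R M, ∃ c : ℂ, ∀ w, φ w = c • w := by
    intro φ
    let ψ : Module.End ℂ M := φ.restrictScalars ℂ
    obtain ⟨c, hc⟩ := Module.End.exists_eigenvalue ψ
    obtain ⟨e, he, he0⟩ := hc.exists_hasEigenvector
    have heig : ∀ s ∈ S, ∀ w ∈ Module.End.eigenspace ψ c, s w ∈ Module.End.eigenspace ψ c := by
      intro s hs w hw
      rw [Module.End.mem_eigenspace_iff] at hw ⊢
      have : ψ (s w) = s (ψ w) := φ.map_smul (⟨s, Algebra.subset_adjoin hs⟩ : R) w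
      rw [this, hw, map_smul]
    rcases hS (Module.End.eigenspace ψ c) heig with h | h
    · have he' : e ∈ Module.End.eigenspace ψ c := he
      rw [h] at he'
      exact absurd he' he0
    · refine ⟨c, fun w => ?_⟩
      have : w ∈ Module.End.eigenspace ψ c := by rw [h]; trivial
      exact Module.End.mem_eigenspace_iff.mp this
  rw [eq_top_iff]
  intro T _
  -- The `R`-endomorphisms being scalars, every linear `T` lies in the double commutant; the density
  -- theorem then matches `T` with an element of `R` on a basis.
  let T' : Module.End (Module.End R M) M :=
    { toFun := T
      map_add' := map_add T
      map_smul' := fun φ w => by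
        obtain ⟨c, hc⟩ := hschur φ
        change T (φ w) = φ (T w)
        rw [hc, hc, map_smul] }
  let b := Module.finBasis ℂ M
  obtain ⟨r, hr⟩ := jacobson_density (R := R) T' (Finset.univ.map ⟨b, b.injective⟩)
  have : T = r.1 := b.ext fun i => hr (b i) (by simp)
  rw [this]
  exact r.2

end LinearAlgebra

/-! ### Parity operators and graded submodules -/

theorem superSign_mul_self (i j : ZMod 2) : superSign i j * superSign i j = 1 := by
  rcases zmod_two_cases i with rfl | rfl <;> rcases zmod_two_cases j with rfl | rfl <;> simp

theorem superSign_add_right (i j k : ZMod 2) :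
    superSign i (j + k) = superSign i j * superSign i k := by
  rcases zmod_two_cases i with rfl | rfl <;> rcases zmod_two_cases j with rfl | rfl <;>
    rcases zmod_two_cases k with rfl | rfl <;> simp [zmod_two_one_add_one]

theorem superSign_comm (i j : ZMod 2) : superSign i j = superSign j i := by
  simp [superSign, and_comm]

namespace SuperSpace

variable {V : Type*} [AddCommGroup V] [Module ℂ V]

theorem signOp_zero (S : SuperSpace V) : S.signOp 0 = LinearMap.id := by
  ext x
  simp [signOp, S.proj_zero_add_proj_one]

theorem induction_homogeneous (S : SuperSpace V) {P : V → Prop}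
    (hom : ∀ i, ∀ x ∈ S.part i, P x) (hadd : ∀ x y, P x → P y → P (x + y)) (x : V) : P x := by
  rw [← S.proj_zero_add_proj_one x]
  exact hadd _ _ (hom 0 _ (S.proj_mem 0 x)) (hom 1 _ (S.proj_mem 1 x))

theorem ext_homogeneous (S : SuperSpace V) {W : Type*} [AddCommGroup W] [Module ℂ W]
    {f g : V →ₗ[ℂ] W} (h : ∀ i, ∀ x ∈ S.part i, f x = g x) : f = g :=
  LinearMap.ext fun x => S.induction_homogeneous h
    (fun x y hx hy => by rw [map_add, map_add, hx, hy]) x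

theorem signOp_signOp (S : SuperSpace V) (i j : ZMod 2) (x : V) :
    S.signOp i (S.signOp j x) = S.signOp (i + j) x := by
  have : S.signOp i ∘ₗ S.signOp j = S.signOp (i + j) := S.ext_homogeneous fun k x hx => by
    rw [LinearMap.comp_apply, S.signOp_apply j hx, map_smul, S.signOp_apply i hx,
      S.signOp_apply _ hx, smul_smul, superSign_comm (i + j), superSign_add_right,
      superSign_comm k, superSign_comm k, mul_comm]
  exact LinearMap.congr_fun this x

theorem signOp_one_signOp_one (S : SuperSpace V) (x : V) : S.signOp 1 (S.signOp 1 x) = x := by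
  rw [signOp_signOp, zmod_two_one_add_one, signOp_zero, LinearMap.id_apply]

theorem proj_eq_signOp (S : SuperSpace V) (i : ZMod 2) (x : V) :
    S.proj i x = (2⁻¹ : ℂ) • (x + superSign 1 i • S.signOp 1 x) := by
  have hx := S.proj_zero_add_proj_one x
  have : S.signOp 1 x = S.proj 0 x - S.proj 1 x := by simp [signOp, sub_eq_add_neg]
  rw [this]
  nth_rewrite 2 [← hx]
  rcases zmod_two_cases i with rfl | rfl <;> simp only [superSign_zero_right, superSign_one_one] <;>
    module

/-- Turns homogeneity into an eigenvector equation for the parity operator, so that degrees can be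
computed by moving signs through linear maps. -/
theorem mem_part_iff (S : SuperSpace V) {i : ZMod 2} {x : V} :
    x ∈ S.part i ↔ S.signOp 1 x = superSign 1 i • x := by
  refine ⟨S.signOp_apply 1, fun h => ?_⟩
  have : S.proj i x = x := by
    rw [proj_eq_signOp, h, smul_smul, superSign_mul_self]
    module
  rw [← this]
  exact S.proj_mem i x

/-- The projections are combinations of the identity and the parity operator, so being graded is
just one more invariance condition, on the same footing as stability under the action. -/
theorem graded_iff (S : SuperSpace V) (N : Submodule ℂ V) :
    N ≤ (N ⊓ S.part 0) ⊔ (N ⊓ S.part 1) ↔ ∀ x ∈ N, S.signOp 1 x ∈ N := by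
  constructor
  · intro h x hx
    obtain ⟨y, hy, z, hz, rfl⟩ := Submodule.mem_sup.mp (h hx)
    rw [map_add, S.signOp_apply 1 hy.2, S.signOp_apply 1 hz.2]
    exact N.add_mem (N.smul_mem _ hy.1) (N.smul_mem _ hz.1)
  · intro h x hx
    have hp : ∀ i, S.proj i x ∈ N := by
      intro i
      rw [proj_eq_signOp]
      exact N.smul_mem _ (N.add_mem hx (N.smul_mem _ (h x hx)))
    rw [← S.proj_zero_add_proj_one x]
    exact Submodule.add_mem_sup ⟨hp 0, S.proj_mem 0 x⟩ ⟨hp 1, S.proj_mem 1 x⟩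

/-- The super space structure given by an involution: its eigenspaces for `1` and `-1`. -/
def ofInvolution (P : V →ₗ[ℂ] V) (hP : ∀ x, P (P x) = x) : SuperSpace V where
  part i := LinearMap.ker (P - superSign 1 i • LinearMap.id)
  isCompl := by
    refine isCompl_of_parity P ?_ ?_ ?_
    · intro x hx
      simpa [sub_eq_zero] using hx
    · intro x hx
      simpa [add_eq_zero_iff_eq_neg] using hx
    · intro x
      have hx : x = (2⁻¹ : ℂ) • (x + P x) + (2⁻¹ : ℂ) • (x - P x) := by module
      rw [hx]
      refine Submodule.add_mem_sup (Submodule.smul_mem _ _ ?_) (Submodule.smul_mem _ _ ?_)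
      · simp [hP, add_comm]
      · simp [hP]

theorem mem_ofInvolution {P : V →ₗ[ℂ] V} {hP : ∀ x, P (P x) = x} {i : ZMod 2} {x : V} :
    x ∈ (ofInvolution P hP).part i ↔ P x = superSign 1 i • x := by
  simp [ofInvolution, sub_eq_zero]

theorem signOp_ofInvolution {P : V →ₗ[ℂ] V} {hP : ∀ x, P (P x) = x} (x : V) :
    (ofInvolution P hP).signOp 1 x = P x := by
  have : (ofInvolution P hP).signOp 1 = P := ext_homogeneous (ofInvolution P hP) fun i x hx => by
    rw [signOp_apply _ 1 hx, mem_ofInvolution.mp hx]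
  rw [this]

/-- The super space structure on a graded subspace. -/
def restrict (S : SuperSpace V) (N : Submodule ℂ V) (hN : ∀ x ∈ N, S.signOp 1 x ∈ N) :
    SuperSpace N :=
  ofInvolution ((S.signOp 1).restrict hN) fun x => Subtype.ext (S.signOp_one_signOp_one x)

theorem mem_restrict {S : SuperSpace V} {N : Submodule ℂ V} {hN : ∀ x ∈ N, S.signOp 1 x ∈ N}
    {i : ZMod 2} {x : N} : x ∈ (S.restrict N hN).part i ↔ (x : V) ∈ S.part i := by
  rw [restrict, mem_ofInvolution, mem_part_iff, Subtype.ext_iff]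
  rfl

theorem signOp_restrict {S : SuperSpace V} {N : Submodule ℂ V} {hN : ∀ x ∈ N, S.signOp 1 x ∈ N}
    (i : ZMod 2) (x : N) : (((S.restrict N hN).signOp i x : N) : V) = S.signOp i x := by
  rcases zmod_two_cases i with rfl | rfl
  · simp [signOp_zero]
  · rw [restrict, signOp_ofInvolution]
    rfl

end SuperSpace

namespace SuperModule

variable {L : Type*} [AddCommGroup L] [Module ℂ L] [LieSuperalgebra L]

theorem isSubmodule_iff (V : SuperModule.{v} L) (N : Submodule ℂ V.carrier) :
    V.IsSubmodule N ↔
      (∀ w ∈ N, V.space.signOp 1 w ∈ N) ∧ ∀ x : L, ∀ w ∈ N, V.action x w ∈ N := by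
  rw [IsSubmodule, V.space.graded_iff]

theorem signOp_action (V : SuperModule.{v} L) (i : ZMod 2) {j : ZMod 2} {x : L}
    (hx : x ∈ LieSuperalgebra.part L j) (w : V.carrier) :
    V.space.signOp i (V.action x w) = superSign i j • V.action x (V.space.signOp i w) := by
  have : V.space.signOp i ∘ₗ V.action x = superSign i j • (V.action x ∘ₗ V.space.signOp i) :=
    V.space.ext_homogeneous fun k w hw => by
      rw [LinearMap.comp_apply, LinearMap.smul_apply, LinearMap.comp_apply,
        V.space.signOp_apply i (V.action_mem hx hw), V.space.signOp_apply i hw, map_smul,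
        smul_smul, superSign_add_right]
  exact LinearMap.congr_fun this w

theorem action_action (V : SuperModule.{v} L) {i j : ZMod 2} {x y : L}
    (hx : x ∈ LieSuperalgebra.part L i) (hy : y ∈ LieSuperalgebra.part L j) (w : V.carrier) :
    V.action x (V.action y w) =
      V.action (LieSuperalgebra.bracket x y) w + superSign i j • V.action y (V.action x w) := by
  rw [V.action_bracket hx hy, sub_add_cancel]

/-- The restriction of a module to a submodule. -/
def restrict (V : SuperModule.{v} L) (N : Submodule ℂ V.carrier) (hN : V.IsSubmodule N) :
    SuperModule.{v} L where
  carrier := N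
  space := V.space.restrict N ((V.isSubmodule_iff N).mp hN).1
  action :=
    { toFun := fun x => (V.action x).restrict (hN.2 x)
      map_add' := fun x y => by ext w; simp
      map_smul' := fun c x => by ext w; simp }
  action_mem {i j x w} hx hw :=
    SuperSpace.mem_restrict.mpr (V.action_mem hx (SuperSpace.mem_restrict.mp hw))
  action_bracket {i j x y} hx hy w := Subtype.ext (V.action_bracket hx hy (w : V.carrier))

theorem exists_irreducible_submodule (V : SuperModule.{v} L) [FiniteDimensional ℂ V.carrier]
    [Nontrivial V.carrier] :
    ∃ (N : Submodule ℂ V.carrier) (hN : V.IsSubmodule N), (V.restrict N hN).IsIrreducible := by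
  obtain ⟨N, -, hN, hsub, hmin⟩ := exists_minimal_submodule V.IsSubmodule (N := ⊤) top_ne_bot
    ((V.isSubmodule_iff ⊤).mpr (by simp))
  refine ⟨N, hsub, Submodule.nontrivial_iff_ne_bot.mpr hN, fun K hK => ?_⟩
  rw [isSubmodule_iff] at hK
  suffices h : ∀ K : Submodule ℂ N, (∀ w ∈ K, (V.restrict N hsub).space.signOp 1 w ∈ K) →
      (∀ x : L, ∀ w ∈ K, (V.restrict N hsub).action x w ∈ K) → K = ⊥ ∨ K = ⊤ from
    h K hK.1 hK.2
  intro K hK1 hK2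
  have hKV : V.IsSubmodule (K.map N.subtype) := by
    rw [isSubmodule_iff]
    constructor
    · rintro _ ⟨k, hk, rfl⟩
      exact ⟨_, hK1 k hk, SuperSpace.signOp_restrict 1 k⟩
    · rintro x _ ⟨k, hk, rfl⟩
      exact ⟨_, hK2 x k hk, rfl⟩
  rcases hmin (K.map N.subtype) (Submodule.map_subtype_le N K) hKV with h | h
  · left
    exact Submodule.map_injective_of_injective N.injective_subtype
      (h.trans (Submodule.map_bot _).symm)
  · right
    rw [eq_top_iff]
    intro x _
    have hx : (x : V.carrier) ∈ K.map N.subtype := by rw [h]; exact x.2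
    obtain ⟨k, hk, hkx⟩ := hx
    have : k = x := Subtype.ext hkx
    rwa [← this]

end SuperModule

/-! ### Factorization of irreducible modules -/

namespace SuperModule

variable {L' : Type*} [AddCommGroup L'] [Module ℂ L'] [LieSuperalgebra L']
  {L : Type*} [AddCommGroup L] [Module ℂ L] [LieSuperalgebra L]

/-- The linear maps `W → X` that commute with the action of `L`. -/
def intertwiners (W X : SuperModule.{v} L) : Submodule ℂ (W.carrier →ₗ[ℂ] X.carrier) where
  carrier := {f | ∀ (x : L) (w : W.carrier), f (W.action x w) = X.action x (f w)}
  zero_mem' x w := by simp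
  add_mem' {f g} hf hg x w := by simp [hf x w, hg x w]
  smul_mem' c f hf x w := by simp [hf x w]

/-- Intertwiners carry no sign, even the odd ones. Moving a homogeneous `x` past both parity
operators produces the same sign twice, so conjugation by parity preserves them and defines their
grading. -/
theorem conj_signOp_mem_intertwiners (W X : SuperModule.{v} L) {f : W.carrier →ₗ[ℂ] X.carrier}
    (hf : f ∈ intertwiners W X) :
    X.space.signOp 1 ∘ₗ f ∘ₗ W.space.signOp 1 ∈ intertwiners W X := by
  intro x w
  refine (LieSuperalgebra.space (L := L)).induction_homogeneous
    (P := fun x => (X.space.signOp 1 ∘ₗ f ∘ₗ W.space.signOp 1) (W.action x w) =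
      X.action x ((X.space.signOp 1 ∘ₗ f ∘ₗ W.space.signOp 1) w)) ?_ ?_ x
  · intro i x hx
    simp only [LinearMap.comp_apply]
    rw [W.signOp_action 1 hx, map_smul, hf x, map_smul, X.signOp_action 1 hx, smul_smul,
      superSign_mul_self, one_smul]
  · intro x y hx hy
    simp only [map_add, LinearMap.add_apply, hx, hy]

/-- The grading of the space of intertwiners by parity. -/
def intertwinersSpace (W X : SuperModule.{v} L) : SuperSpace (intertwiners W X) :=
  SuperSpace.ofInvolution
    (LinearMap.restrict
      (LinearMap.lcomp ℂ X.carrier (W.space.signOp 1) ∘ₗ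
        LinearMap.llcomp ℂ W.carrier X.carrier X.carrier (X.space.signOp 1))
      (fun _ hf => conj_signOp_mem_intertwiners W X hf))
    (fun f => by
      refine Subtype.ext (LinearMap.ext fun w => ?_)
      change X.space.signOp 1 (X.space.signOp 1 (f.1 (W.space.signOp 1 (W.space.signOp 1 w)))) =
        f.1 w
      rw [SuperSpace.signOp_one_signOp_one, SuperSpace.signOp_one_signOp_one])

theorem mem_intertwinersSpace {W X : SuperModule.{v} L} {i : ZMod 2} {f : intertwiners W X} :
    f ∈ (intertwinersSpace W X).part i ↔
      ∀ w, X.space.signOp 1 (f.1 (W.space.signOp 1 w)) = superSign 1 i • f.1 w := by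
  rw [intertwinersSpace, SuperSpace.mem_ofInvolution, Subtype.ext_iff, LinearMap.ext_iff]
  rfl

theorem intertwiner_apply_mem {W X : SuperModule.{v} L} {i j : ZMod 2} {f : intertwiners W X}
    (hf : f ∈ (intertwinersSpace W X).part i) {w : W.carrier} (hw : w ∈ W.space.part j) :
    f.1 w ∈ X.space.part (i + j) := by
  have h := mem_intertwinersSpace.mp hf w
  rw [W.space.signOp_apply 1 hw, map_smul, map_smul] at h
  rw [SuperSpace.mem_part_iff, superSign_add_right, mul_comm, ← smul_smul, ← h, smul_smul,
    superSign_mul_self, one_smul]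

/-- An action of `L'` on the super space underlying the `L`-module `X` that supercommutes with the
action of `L`. -/
structure CommutingAction (L' : Type*) [AddCommGroup L'] [Module ℂ L'] [LieSuperalgebra L']
    (X : SuperModule.{v} L) where
  action : L' →ₗ[ℂ] Module.End ℂ X.carrier
  action_mem : ∀ {i j : ZMod 2} {y : L'} {w : X.carrier}, y ∈ LieSuperalgebra.part L' i →
    w ∈ X.space.part j → action y w ∈ X.space.part (i + j)
  action_bracket : ∀ {i j : ZMod 2} {x y : L'}, x ∈ LieSuperalgebra.part L' i →
    y ∈ LieSuperalgebra.part L' j → ∀ w : X.carrier,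
    action (LieSuperalgebra.bracket x y) w =
      action x (action y w) - superSign i j • action y (action x w)
  commute : ∀ {i j : ZMod 2} {x : L} {y : L'}, x ∈ LieSuperalgebra.part L i →
    y ∈ LieSuperalgebra.part L' j → ∀ w : X.carrier,
    X.action x (action y w) = superSign i j • action y (X.action x w)

variable {X : SuperModule.{v} L}

/-- The `L'`-module with underlying space `X` given by a commuting action. -/
def CommutingAction.toSuperModule (ρ : CommutingAction L' X) : SuperModule.{v} L' where
  carrier := X.carrier
  space := X.space
  action := ρ.action
  action_mem := ρ.action_mem
  action_bracket := ρ.action_bracket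

theorem CommutingAction.signOp_action (ρ : CommutingAction L' X) (i : ZMod 2) {j : ZMod 2} {y : L'}
    (hy : y ∈ LieSuperalgebra.part L' j) (w : X.carrier) :
    X.space.signOp i (ρ.action y w) = superSign i j • ρ.action y (X.space.signOp i w) :=
  ρ.toSuperModule.signOp_action i hy w

/-- The linear map `f ↦ y ∘ f ∘ σ_i` on intertwiners for the homogeneous component of degree `i`
of `y`. -/
def intertwinersActionPart (W : SuperModule.{v} L) (ρ : CommutingAction L' X) (i : ZMod 2) :
    L' →ₗ[ℂ] Module.End ℂ (intertwiners W X) where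
  toFun y := LinearMap.restrict
    (LinearMap.lcomp ℂ X.carrier (W.space.signOp i) ∘ₗ
      LinearMap.llcomp ℂ W.carrier X.carrier X.carrier
        (ρ.action ((LieSuperalgebra.space (L := L')).proj i y))) (by
      intro f hf x w
      refine (LieSuperalgebra.space (L := L)).induction_homogeneous (P := fun x =>
        ρ.action ((LieSuperalgebra.space (L := L')).proj i y)
          (f (W.space.signOp i (W.action x w))) =
        X.action x (ρ.action ((LieSuperalgebra.space (L := L')).proj i y)
          (f (W.space.signOp i w)))) ?_ ?_ x
      · intro j x hx
        -- The twist by `σ_i` produces exactly the sign from the supercommutation of `y` with `x`;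
        -- without it the result would only be an intertwiner up to sign.
        rw [W.signOp_action i hx, map_smul, map_smul, hf x,
          ρ.commute hx (SuperSpace.proj_mem _ i y), superSign_comm]
      · intro x y hx hy
        simp only [map_add, LinearMap.add_apply, hx, hy])
  map_add' x y := by
    ext f w
    simp only [map_add]
    rfl
  map_smul' c x := by
    ext f w
    simp only [map_smul]
    rfl

/-- The action of `L'` on intertwiners. -/
def intertwinersAction (W : SuperModule.{v} L) (ρ : CommutingAction L' X) :
    L' →ₗ[ℂ] Module.End ℂ (intertwiners W X) :=
  intertwinersActionPart W ρ 0 + intertwinersActionPart W ρ 1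

theorem intertwinersAction_apply (W : SuperModule.{v} L) (ρ : CommutingAction L' X) {i : ZMod 2}
    {y : L'} (hy : y ∈ LieSuperalgebra.part L' i) (f : intertwiners W X) (w : W.carrier) :
    (intertwinersAction W ρ y f).1 w = ρ.action y (f.1 (W.space.signOp i w)) := by
  have h : (intertwinersAction W ρ y f).1 w =
      ρ.action ((LieSuperalgebra.space (L := L')).proj 0 y) (f.1 (W.space.signOp 0 w)) +
      ρ.action ((LieSuperalgebra.space (L := L')).proj 1 y) (f.1 (W.space.signOp 1 w)) := rfl
  rw [h]
  rcases zmod_two_cases i with rfl | rfl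
  · rw [SuperSpace.proj_self _ hy, SuperSpace.proj_of_ne _ zero_ne_one hy]
    simp
  · rw [SuperSpace.proj_self _ hy, SuperSpace.proj_of_ne _ one_ne_zero hy]
    simp

/-- The `L'`-module of intertwiners. -/
def intertwinersModule (W : SuperModule.{v} L) (ρ : CommutingAction L' X) :
    SuperModule.{v} L' where
  carrier := intertwiners W X
  space := intertwinersSpace W X
  action := intertwinersAction W ρ
  action_mem {i j y f} hy hf := by
    rw [mem_intertwinersSpace] at hf ⊢
    intro w
    rw [intertwinersAction_apply W ρ hy, intertwinersAction_apply W ρ hy, ρ.signOp_action 1 hy,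
      SuperSpace.signOp_signOp, add_comm i 1, ← SuperSpace.signOp_signOp, hf, map_smul, smul_smul,
      superSign_add_right]
  action_bracket {i j x y} hx hy f := by
    apply Subtype.ext
    ext w
    change _ = (intertwinersAction W ρ x (intertwinersAction W ρ y f)).1 w -
      superSign i j • (intertwinersAction W ρ y (intertwinersAction W ρ x f)).1 w
    rw [intertwinersAction_apply W ρ (LieSuperalgebra.bracket_mem hx hy),
      intertwinersAction_apply W ρ hx, intertwinersAction_apply W ρ hy,
      intertwinersAction_apply W ρ hy, intertwinersAction_apply W ρ hx,
      SuperSpace.signOp_signOp, SuperSpace.signOp_signOp, add_comm j i, ρ.action_bracket hx hy]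

/-- The evaluation map `W ⊗ Hom(W, X) → X`. -/
def evalIntertwiner (W X : SuperModule.{v} L) :
    W.carrier ⊗[ℂ] intertwiners W X →ₗ[ℂ] X.carrier :=
  TensorProduct.lift (LinearMap.flip (intertwiners W X).subtype)

theorem evalIntertwiner_tmul (W X : SuperModule.{v} L) (w : W.carrier) (f : intertwiners W X) :
    evalIntertwiner W X (w ⊗ₜ f) = f.1 w := rfl

/-- The evaluation map is injective if `W` is irreducible as an ungraded module. -/
theorem evalIntertwiner_injective (W X : SuperModule.{v} L) [FiniteDimensional ℂ W.carrier]
    [Nontrivial W.carrier]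
    (hW : ∀ N : Submodule ℂ W.carrier, (∀ x : L, ∀ w ∈ N, W.action x w ∈ N) → N = ⊥ ∨ N = ⊤) :
    Function.Injective (evalIntertwiner W X) := by
  have htop : Algebra.adjoin ℂ (Set.range W.action) = ⊤ :=
    adjoin_eq_top_of_no_invariant_submodule _ fun N hN =>
      hW N fun x w hw => hN _ ⟨x, rfl⟩ w hw
  -- The kernel is stable under `L` acting on the left factor alone, hence by Burnside under every
  -- `T ⊗ 1`.
  have hstab : ∀ (T : Module.End ℂ W.carrier) (t : W.carrier ⊗[ℂ] intertwiners W X),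
      evalIntertwiner W X t = 0 → evalIntertwiner W X (T.rTensor _ t) = 0 := by
    intro T
    have hT : T ∈ Algebra.adjoin ℂ (Set.range W.action) := by rw [htop]; trivial
    induction hT using Algebra.adjoin_induction with
    | mem T hT =>
      obtain ⟨x, rfl⟩ := hT
      have key : ∀ t, evalIntertwiner W X ((W.action x).rTensor _ t) =
          X.action x (evalIntertwiner W X t) := by
        intro t
        induction t with
        | zero => simp
        | add s t hs ht => simp only [map_add, hs, ht]
        | tmul w f =>
          rw [LinearMap.rTensor_tmul, evalIntertwiner_tmul, evalIntertwiner_tmul]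
          exact f.2 x w
      intro t ht
      rw [key, ht, map_zero]
    | algebraMap c =>
      intro t ht
      rw [Algebra.algebraMap_eq_smul_one, LinearMap.rTensor_smul, LinearMap.smul_apply, map_smul,
        Module.End.one_eq_id, LinearMap.rTensor_id, LinearMap.id_apply, ht, smul_zero]
    | add S T _ _ hS hT =>
      intro t ht
      rw [LinearMap.rTensor_add, LinearMap.add_apply, map_add, hS t ht, hT t ht, add_zero]
    | mul S T _ _ hS hT =>
      intro t ht
      rw [Module.End.mul_eq_comp, LinearMap.rTensor_comp_apply]
      exact hS _ (hT t ht)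
  rw [← LinearMap.ker_eq_bot, LinearMap.ker_eq_bot']
  intro t ht
  let b := Module.finBasis ℂ W.carrier
  let e := TensorProduct.equivFinsuppOfBasisLeft (N := intertwiners W X) b
  have ht' : t = (e t).sum fun i f => b i ⊗ₜ f := by
    rw [← TensorProduct.equivFinsuppOfBasisLeft_symm_apply, LinearEquiv.symm_apply_apply]
  suffices h : e t = 0 by simpa using h
  ext1 j
  apply Subtype.ext
  refine b.ext fun a => ?_
  -- The matrix unit sending `b j` to `b a` isolates the `j`-th coefficient `f` of `t`: the stable
  -- kernel then contains `b a ⊗ f`, that is, `f (b a) = 0`.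
  have h := hstab (b.constr ℂ fun k => if k = j then b a else 0) t ht
  rw [ht', Finsupp.sum_fintype _ _ (by simp), map_sum, map_sum] at h
  simpa [LinearMap.rTensor_tmul, Module.Basis.constr_basis, evalIntertwiner_tmul, ite_apply,
    TensorProduct.ite_tmul, apply_ite, Finset.sum_ite_eq] using h

/-! ### Isomorphisms, and irreducibility of tensor factors -/

/-- The inverse of an isomorphism. -/
def Iso.symm {V W : SuperModule.{v} L} (e : Iso V W) : Iso W V where
  toLinearEquiv := e.toLinearEquiv.symm
  map_mem {i w} hw := by
    have h : e.toLinearEquiv.toLinearMap ∘ₗ V.space.signOp 1 =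
        W.space.signOp 1 ∘ₗ e.toLinearEquiv.toLinearMap :=
      V.space.ext_homogeneous fun i w hw => by
        simp only [LinearMap.comp_apply, LinearEquiv.coe_coe]
        rw [V.space.signOp_apply 1 hw, W.space.signOp_apply 1 (e.map_mem hw), map_smul]
    have h' := LinearMap.congr_fun h (e.toLinearEquiv.symm w)
    rw [SuperSpace.mem_part_iff] at hw ⊢
    apply e.toLinearEquiv.injective
    simpa [hw] using h'
  map_action x w := by
    apply e.toLinearEquiv.injective
    simp [e.map_action]

/-- The composition of isomorphisms. -/
def Iso.trans {U V W : SuperModule.{v} L} (e : Iso U V) (f : Iso V W) : Iso U W where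
  toLinearEquiv := e.toLinearEquiv.trans f.toLinearEquiv
  map_mem hw := f.map_mem (e.map_mem hw)
  map_action x w := by simp [e.map_action, f.map_action]

theorem Iso.isIrreducible {V W : SuperModule.{v} L} (e : Iso V W) (hV : V.IsIrreducible) :
    W.IsIrreducible := by
  have := hV.1
  refine ⟨e.toLinearEquiv.symm.toEquiv.nontrivial, fun N hN => ?_⟩
  rw [isSubmodule_iff] at hN
  have hcomap : V.IsSubmodule (N.comap e.toLinearEquiv.toLinearMap) := by
    rw [isSubmodule_iff]
    constructor
    · intro w hw
      have h : e.toLinearEquiv.toLinearMap ∘ₗ V.space.signOp 1 =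
          W.space.signOp 1 ∘ₗ e.toLinearEquiv.toLinearMap :=
        V.space.ext_homogeneous fun i w hw => by
          simp only [LinearMap.comp_apply, LinearEquiv.coe_coe]
          rw [V.space.signOp_apply 1 hw, W.space.signOp_apply 1 (e.map_mem hw), map_smul]
      have h' := LinearMap.congr_fun h w
      simp only [LinearMap.comp_apply] at h'
      rw [Submodule.mem_comap, h']
      exact hN.1 _ hw
    · intro x w hw
      rw [Submodule.mem_comap, LinearEquiv.coe_coe, e.map_action]
      exact hN.2 x _ hw
  have hmap : (N.comap e.toLinearEquiv.toLinearMap).map e.toLinearEquiv.toLinearMap = N :=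
    Submodule.map_comap_eq_of_surjective e.toLinearEquiv.surjective N
  rcases hV.2 _ hcomap with h | h
  · left
    rw [← hmap, h, Submodule.map_bot]
  · right
    rw [← hmap, h, Submodule.map_top, LinearEquiv.range]

/-- The tensor action is only explicit on homogeneous elements; by linearity, equivariance of a map
out of a tensor product need only be checked there. -/
theorem tensorAction_induction (P Q : SuperModule.{v} L') {Z : Type*} [AddCommGroup Z] [Module ℂ Z]
    (F : P.carrier ⊗[ℂ] Q.carrier →ₗ[ℂ] Z) (a : L' →ₗ[ℂ] Module.End ℂ Z)
    (h : ∀ {i j : ZMod 2} {y : L'} {p : P.carrier} (q : Q.carrier),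
      y ∈ LieSuperalgebra.part L' i → p ∈ P.space.part j →
      F (P.action y p ⊗ₜ q) + superSign i j • F (p ⊗ₜ Q.action y q) = a y (F (p ⊗ₜ q)))
    (y : L') (t : P.carrier ⊗[ℂ] Q.carrier) : F (tensorAction P Q y t) = a y (F t) := by
  induction t with
  | zero => simp
  | add s t hs ht => simp only [map_add, hs, ht]
  | tmul p q =>
    refine (LieSuperalgebra.space (L := L')).induction_homogeneous (P := fun y =>
      F (tensorAction P Q y (p ⊗ₜ q)) = a y (F (p ⊗ₜ q))) ?_ ?_ y
    · intro i y hy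
      refine P.space.induction_homogeneous (P := fun p =>
        F (tensorAction P Q y (p ⊗ₜ q)) = a y (F (p ⊗ₜ q))) ?_ ?_ p
      · intro j p hp
        rw [tensorAction_tmul P Q hy hp, map_add, map_smul]
        exact h q hy hp
      · intro w w' hw hw'
        simp only [TensorProduct.add_tmul, map_add, hw, hw']
    · intro x y hx hy
      simp only [map_add, LinearMap.add_apply, hx, hy]

theorem evalIntertwiner_mem (W : SuperModule.{v} L) (φ : LieSuperHom L' L)
    (ρ : CommutingAction L' X) {i : ZMod 2} {t : W.carrier ⊗[ℂ] intertwiners W X}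
    (ht : t ∈ (tensor (W.pullback φ) (intertwinersModule W ρ)).space.part i) :
    evalIntertwiner W X t ∈ X.space.part i := by
  change t ∈ SuperSpace.tensorPart W.space (intertwinersSpace W X) i at ht
  induction ht using Submodule.span_induction with
  | zero => simp
  | add s t _ _ hs ht => simpa using Submodule.add_mem _ hs ht
  | smul c t _ ht => simpa using Submodule.smul_mem _ c ht
  | mem t ht =>
    obtain ⟨i, j, rfl, w, hw, f, hf, rfl⟩ := ht
    rw [evalIntertwiner_tmul, add_comm]
    exact intertwiner_apply_mem hf hw

/-- The sign `(-1)^{|y||w|}` of the tensor action cancels the twist by `σ_i` in the action on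
intertwiners, which leaves the untwisted `ρ.action y (f w)`. -/
theorem evalIntertwiner_action (W : SuperModule.{v} L) (φ : LieSuperHom L' L)
    (ρ : CommutingAction L' X) (y : L') (t : W.carrier ⊗[ℂ] intertwiners W X) :
    evalIntertwiner W X (tensorAction (W.pullback φ) (intertwinersModule W ρ) y t) =
      (X.action ∘ₗ φ.toLinearMap + ρ.action) y (evalIntertwiner W X t) := by
  refine tensorAction_induction (W.pullback φ) (intertwinersModule W ρ) (evalIntertwiner W X)
    (X.action ∘ₗ φ.toLinearMap + ρ.action) (fun {i j y w} f hy hw => ?_) y t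
  have h1 : evalIntertwiner W X ((W.pullback φ).action y w ⊗ₜ f) =
      X.action (φ.toLinearMap y) (f.1 w) := f.2 (φ.toLinearMap y) w
  have h2 : ∀ (f : intertwiners W X) (w : W.carrier), w ∈ W.space.part j →
      superSign i j • ρ.action y (f.1 (W.space.signOp i w)) = ρ.action y (f.1 w) := by
    intro f w hw
    rw [W.space.signOp_apply i hw, map_smul, map_smul, smul_smul, superSign_mul_self, one_smul]
  exact congrArg₂ (· + ·) h1
    ((congrArg (superSign i j • ·) (intertwinersAction_apply W ρ hy f w)).trans (h2 f w hw))

theorem eq_zero_of_tmul_eq_zero {P Q : Type*} [AddCommGroup P] [Module ℂ P] [AddCommGroup Q]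
    [Module ℂ Q] {p : P} (hp : p ≠ 0) {q : Q} (h : p ⊗ₜ[ℂ] q = 0) : q = 0 := by
  obtain ⟨f, hf⟩ : ∃ f : Module.Dual ℂ P, f p ≠ 0 := by
    by_contra! hf
    exact hp ((Module.forall_dual_apply_eq_zero_iff ℂ p).mp hf)
  have hlid := congrArg (fun t => TensorProduct.lid ℂ Q (f.rTensor Q t)) h
  simpa [hf] using hlid

/-- If `P ⊗ Q` is irreducible, then so is `Q`. -/
theorem isIrreducible_of_tensor {P Q : SuperModule.{v} L} (h : (tensor P Q).IsIrreducible) :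
    Q.IsIrreducible := by
  obtain ⟨hnt, hsub⟩ := h
  change Nontrivial (P.carrier ⊗[ℂ] Q.carrier) at hnt
  have hP : Nontrivial P.carrier := by
    by_contra hP
    rw [not_nontrivial_iff_subsingleton] at hP
    exact not_subsingleton (P.carrier ⊗[ℂ] Q.carrier) inferInstance
  have hQ : Nontrivial Q.carrier := by
    by_contra hQ
    rw [not_nontrivial_iff_subsingleton] at hQ
    exact not_subsingleton (P.carrier ⊗[ℂ] Q.carrier) inferInstance
  refine ⟨hQ, fun K hK => ?_⟩
  obtain ⟨p, hp⟩ := exists_ne (0 : P.carrier)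
  rw [isSubmodule_iff] at hK
  -- A submodule `K` of `Q` gives the submodule `P ⊗ K` of `P ⊗ Q`.
  let R : Submodule ℂ (P.carrier ⊗[ℂ] Q.carrier) := LinearMap.range (K.subtype.lTensor P.carrier)
  have htmul : ∀ p, ∀ k ∈ K, p ⊗ₜ[ℂ] k ∈ R := fun p k hk => ⟨p ⊗ₜ ⟨k, hk⟩, rfl⟩
  have hsign : (SuperSpace.tensor P.space Q.space).signOp 1 =
      TensorProduct.map (P.space.signOp 1) (Q.space.signOp 1) :=
    SuperSpace.ext_homogeneous _ fun i t ht =>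
      (SuperSpace.signOp_apply _ 1 ht).trans
        (SuperSpace.parity_tensorPart P.space Q.space ht).symm
  have hR1 : ∀ t ∈ R, (SuperSpace.tensor P.space Q.space).signOp 1 t ∈ R := by
    rintro _ ⟨t, rfl⟩
    rw [hsign]
    induction t with
    | zero => simp
    | add s t hs ht => simpa using R.add_mem hs ht
    | tmul p k => exact htmul _ _ (hK.1 k k.2)
  have hR2 : ∀ x, ∀ t ∈ R, tensorAction P Q x t ∈ R := by
    rintro x _ ⟨t, rfl⟩
    induction t with
    | zero => simp
    | add s t hs ht => simpa using R.add_mem hs ht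
    | tmul p k =>
      exact R.add_mem (R.add_mem (htmul _ _ k.2) (htmul _ _ (hK.2 _ k k.2)))
        (htmul _ _ (hK.2 _ k k.2))
  have hR : R = ⊥ ∨ R = ⊤ := hsub R ((isSubmodule_iff (tensor P Q) R).mpr ⟨hR1, hR2⟩)
  rcases hR with h | h
  · left
    rw [eq_bot_iff]
    intro k hk
    have hk' := htmul p k hk
    rw [h, Submodule.mem_bot] at hk'
    exact eq_zero_of_tmul_eq_zero hp hk'
  · right
    rw [eq_top_iff]
    intro q _
    have hq : p ⊗ₜ[ℂ] q ∈ R := by rw [h]; trivial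
    obtain ⟨t, ht⟩ := hq
    -- Passing to `P ⊗ (Q / K)` kills `P ⊗ K`, and `p ≠ 0` then forces `q ∈ K`.
    have h0 : p ⊗ₜ[ℂ] K.mkQ q = 0 := by
      rw [← LinearMap.lTensor_tmul, ← ht, ← LinearMap.lTensor_comp_apply]
      have hcomp : K.mkQ ∘ₗ K.subtype = 0 := by ext; simp
      rw [hcomp, LinearMap.lTensor_zero, LinearMap.zero_apply]
    simpa using eq_zero_of_tmul_eq_zero hp h0

/-- An irreducible module on which `L'` acts through the sum of the pull-back of an `L`-module and
a supercommuting action is a tensor product, provided that the irreducible `L`-modules stay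
irreducible when the grading is forgotten. -/
theorem exists_tensor_factorization (V : SuperModule.{v} L') (hirr : V.IsIrreducible)
    [FiniteDimensional ℂ X.carrier] (φ : LieSuperHom L' L) (ρ : CommutingAction L' X)
    (e : X.carrier ≃ₗ[ℂ] V.carrier) (he : ∀ i, ∀ w ∈ X.space.part i, e w ∈ V.space.part i)
    (hact : ∀ y w, V.action y (e w) = e (X.action (φ.toLinearMap y) w + ρ.action y w))
    (hL : ∀ W : SuperModule.{v} L, FiniteDimensional ℂ W.carrier → W.IsIrreducible →
      ∀ N : Submodule ℂ W.carrier, (∀ x : L, ∀ w ∈ N, W.action x w ∈ N) → N = ⊥ ∨ N = ⊤) :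
    ∃ W : SuperModule.{v} L, FiniteDimensional ℂ W.carrier ∧ W.IsIrreducible ∧
      FiniteDimensional ℂ (intertwinersModule W ρ).carrier ∧
      (intertwinersModule W ρ).IsIrreducible ∧
      Nonempty (Iso V (tensor (W.pullback φ) (intertwinersModule W ρ))) := by
  have := hirr.1
  have : Nontrivial X.carrier := e.toEquiv.nontrivial
  obtain ⟨N, hN, hW⟩ := X.exists_irreducible_submodule
  let W := X.restrict N hN
  have hWfin : FiniteDimensional ℂ W.carrier :=
    inferInstanceAs (FiniteDimensional ℂ N)
  have hWnt : Nontrivial W.carrier := hW.1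
  have hUfin : FiniteDimensional ℂ (intertwiners W X) := inferInstance
  let T := tensor (W.pullback φ) (intertwinersModule W ρ)
  let F : T.carrier →ₗ[ℂ] V.carrier := e.toLinearMap ∘ₗ evalIntertwiner W X
  have hinj : Function.Injective F :=
    e.injective.comp (evalIntertwiner_injective W X (hL W hWfin hW))
  have hFmem : ∀ i, ∀ t ∈ T.space.part i, F t ∈ V.space.part i := fun i t ht =>
    he i _ (evalIntertwiner_mem W φ ρ ht)
  have hFact : ∀ y t, F (T.action y t) = V.action y (F t) := fun y t =>
    (congrArg e (evalIntertwiner_action W φ ρ y t)).trans (hact y _).symm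
  have hsurj : Function.Surjective F := by
    have hsub : V.IsSubmodule (LinearMap.range F) := by
      rw [isSubmodule_iff]
      constructor
      · have h : F ∘ₗ T.space.signOp 1 = V.space.signOp 1 ∘ₗ F :=
          T.space.ext_homogeneous fun i w hw => by
            simp only [LinearMap.comp_apply]
            rw [T.space.signOp_apply 1 hw, V.space.signOp_apply 1 (hFmem i w hw), map_smul]
        rintro _ ⟨t, rfl⟩
        exact ⟨T.space.signOp 1 t, LinearMap.congr_fun h t⟩
      · rintro y _ ⟨t, rfl⟩
        exact ⟨T.action y t, hFact y t⟩
    rcases hirr.2 _ hsub with h | h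
    · exfalso
      obtain ⟨w, hw⟩ := exists_ne (0 : W.carrier)
      -- The inclusion of `W` is itself an intertwiner, so the image of the evaluation map is
      -- nonzero.
      let ι : intertwiners W X := ⟨N.subtype, fun x w => rfl⟩
      have h0 : e (N.subtype w) ∈ LinearMap.range F := ⟨w ⊗ₜ[ℂ] ι, rfl⟩
      rw [h, Submodule.mem_bot, e.map_eq_zero_iff] at h0
      exact hw (N.injective_subtype h0)
    · exact LinearMap.range_eq_top.mp h
  let E : Iso T V :=
    { toLinearEquiv := LinearEquiv.ofBijective F ⟨hinj, hsurj⟩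
      map_mem := fun hw => hFmem _ _ hw
      map_action := hFact }
  exact ⟨W, hWfin, hW, hUfin, isIrreducible_of_tensor (E.symm.isIrreducible hirr), ⟨E.symm⟩⟩

end SuperModule

/-! ### Highest weight vectors -/

/-- An even element `h` whose adjoint action is diagonalizable with integer eigenvalues and whose
centralizer is even and abelian. -/
structure LieSuperalgebra.IsRegular {L : Type*} [AddCommGroup L] [Module ℂ L] [LieSuperalgebra L]
    (h : L) : Prop where
  even : h ∈ LieSuperalgebra.part L 0
  span_eq_top : Submodule.span ℂ {x : L | ∃ (i : ZMod 2) (d : ℤ), x ∈ LieSuperalgebra.part L i ∧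
    LieSuperalgebra.bracket h x = (d : ℂ) • x} = ⊤
  centralizer_even : ∀ x, LieSuperalgebra.bracket h x = 0 → x ∈ LieSuperalgebra.part L 0
  centralizer_abelian : ∀ x y, LieSuperalgebra.bracket h x = 0 → LieSuperalgebra.bracket h y = 0 →
    LieSuperalgebra.bracket x y = 0

namespace SuperModule

open LieSuperalgebra (part bracket IsRegular)

variable {L : Type*} [AddCommGroup L] [Module ℂ L] [LieSuperalgebra L]

/-- A vector is singular with respect to `h` if it is killed by the positive part of `L` and is an
eigenvector of the centralizer of `h`. -/
def IsSingular (V : SuperModule.{v} L) (h : L) (w : V.carrier) : Prop :=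
  (∀ (i : ZMod 2) (d : ℤ) (x : L), 0 < d → x ∈ part L i → bracket h x = (d : ℂ) • x →
    V.action x w = 0) ∧
  ∀ x : L, bracket h x = 0 → ∃ c : ℂ, V.action x w = c • w

theorem action_signOp (V : SuperModule.{v} L) {i : ZMod 2} {x : L} (hx : x ∈ part L i)
    (w : V.carrier) :
    V.action x (V.space.signOp 1 w) = superSign 1 i • V.space.signOp 1 (V.action x w) := by
  rw [V.signOp_action 1 hx, smul_smul, superSign_mul_self, one_smul]

/-- Homogeneous elements commute with parity up to sign, which preserves vanishing. The eigenvalues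
are preserved because the centralizer of `h` is even. -/
theorem IsSingular.proj {V : SuperModule.{v} L} {h : L} (hh : IsRegular h) {w : V.carrier}
    (hw : V.IsSingular h w) (k : ZMod 2) : V.IsSingular h (V.space.proj k w) := by
  refine ⟨fun i d x hd hx hhx => ?_, fun x hx => ?_⟩
  · rw [SuperSpace.proj_eq_signOp, map_smul, map_add, map_smul, V.action_signOp hx,
      hw.1 i d x hd hx hhx]
    simp
  · obtain ⟨c, hc⟩ := hw.2 x hx
    refine ⟨c, ?_⟩
    rw [SuperSpace.proj_eq_signOp, map_smul, map_add, map_smul,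
      V.action_signOp (hh.centralizer_even x hx), hc, map_smul, superSign_zero_right]
    module

theorem action_weight (V : SuperModule.{v} L) {h : L} (hh : h ∈ part L 0) {i : ZMod 2} {x : L}
    (hx : x ∈ part L i) {d : ℂ} (hd : bracket h x = d • x) {μ : ℂ} {w : V.carrier}
    (hw : V.action h w = μ • w) : V.action h (V.action x w) = (μ + d) • V.action x w := by
  rw [V.action_action hh hx, hd, hw]
  simp only [map_smul, LinearMap.smul_apply, superSign_zero_left]
  module

theorem bracket_self_eq_zero {h : L} (hh : h ∈ part L 0) : bracket h h = 0 := by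
  have := LieSuperalgebra.bracket_skew hh hh
  rw [superSign_zero_left, one_smul] at this
  have h2 : (2 : ℂ) • bracket h h = 0 := by
    rw [two_smul]
    nth_rewrite 1 [this]
    exact neg_add_cancel _
  exact (smul_eq_zero.mp h2).resolve_left two_ne_zero

/-- Every nonzero stable subspace contains a singular weight vector. -/
theorem exists_isSingular (V : SuperModule.{v} L) [FiniteDimensional ℂ V.carrier] {h : L}
    (hh : IsRegular h) {N : Submodule ℂ V.carrier} (hN : N ≠ ⊥)
    (hstab : ∀ x : L, ∀ w ∈ N, V.action x w ∈ N) :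
    ∃ w ∈ N, w ≠ 0 ∧ V.IsSingular h w := by
  let Λ : Set ℂ := {μ | ∃ w ∈ N, w ≠ 0 ∧ V.action h w = μ • w}
  have hfin : Λ.Finite := by
    refine (Module.End.finite_hasEigenvalue (V.action h)).subset ?_
    rintro μ ⟨w, -, hw0, hw⟩
    exact Module.End.hasEigenvalue_of_hasEigenvector
      (Module.End.hasEigenvector_iff.mpr ⟨Module.End.mem_eigenspace_iff.mpr hw, hw0⟩)
  have hne : Λ.Nonempty := by
    obtain ⟨w, hw, hw0, hc⟩ := exists_common_eigenvector {V.action h} hN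
      (by rintro s rfl w hw; exact hstab h w hw) (by rintro s rfl t rfl w _; rfl)
    obtain ⟨c, hc⟩ := hc _ rfl
    exact ⟨c, w, hw, hw0, hc⟩
  -- The weights are complex numbers, but the positive part raises them by positive integers, so a
  -- weight of maximal real part cannot be raised.
  obtain ⟨μ, ⟨w₀, hw₀N, hw₀, hw₀μ⟩, hmax⟩ := Set.exists_max_image Λ Complex.re hfin hne
  let E := N ⊓ Module.End.eigenspace (V.action h) μ
  have hE : E ≠ ⊥ := by
    intro hE
    have : w₀ ∈ E := ⟨hw₀N, Module.End.mem_eigenspace_iff.mpr hw₀μ⟩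
    rw [hE] at this
    exact hw₀ this
  obtain ⟨w, hw, hw0, hc⟩ := exists_common_eigenvector
    {s | ∃ x, bracket h x = 0 ∧ V.action x = s} hE
    (by
      rintro _ ⟨x, hx, rfl⟩ w ⟨hwN, hw⟩
      refine ⟨hstab x w hwN, Module.End.mem_eigenspace_iff.mpr ?_⟩
      have := V.action_weight hh.even (hh.centralizer_even x hx) (d := 0) (by rw [hx, zero_smul])
        (Module.End.mem_eigenspace_iff.mp hw)
      rwa [add_zero] at this)
    (by
      rintro _ ⟨x, hx, rfl⟩ _ ⟨y, hy, rfl⟩ w -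
      rw [V.action_action (hh.centralizer_even x hx) (hh.centralizer_even y hy),
        hh.centralizer_abelian x y hx hy]
      simp)
  refine ⟨w, hw.1, hw0, fun i d x hd hx hdx => ?_, fun x hx => hc _ ⟨x, hx, rfl⟩⟩
  by_contra hne
  have hmem : μ + d ∈ Λ := ⟨_, hstab x w hw.1, hne,
    V.action_weight hh.even hx hdx (Module.End.mem_eigenspace_iff.mp hw.2)⟩
  have := hmax _ hmem
  rw [Complex.add_re, Complex.intCast_re] at this
  have hd' : (0 : ℝ) < d := by exact_mod_cast hd
  linarith

/-- An irreducible module is generated by a homogeneous singular vector under the negative part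
of `L`. -/
theorem IsSingular.eq_top {V : SuperModule.{v} L} (hV : V.IsIrreducible) {h : L}
    (hh : IsRegular h) {w : V.carrier} (hw : V.IsSingular h w) (hw0 : w ≠ 0) {k : ZMod 2}
    (hwk : w ∈ V.space.part k) {Q : Submodule ℂ V.carrier} (hwQ : w ∈ Q)
    (hQ : ∀ (i : ZMod 2) (d : ℤ) (x : L), d < 0 → x ∈ part L i → bracket h x = (d : ℂ) • x →
      ∀ q ∈ Q, V.action x q ∈ Q) : Q = ⊤ := by
  let IsNeg : Submodule ℂ V.carrier → Prop := fun Q =>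
    ∀ (i : ZMod 2) (d : ℤ) (x : L), d < 0 → x ∈ part L i → bracket h x = (d : ℂ) • x →
      ∀ q ∈ Q, V.action x q ∈ Q
  -- `P` is the smallest subspace containing `w` and stable under the negative part. It suffices
  -- that `P` is a submodule.
  let P : Submodule ℂ V.carrier := sInf {Q | w ∈ Q ∧ IsNeg Q}
  have hPle : ∀ Q, w ∈ Q → IsNeg Q → P ≤ Q := fun Q h1 h2 => sInf_le ⟨h1, h2⟩
  have hwP : w ∈ P := by
    rw [Submodule.mem_sInf]
    exact fun Q hQ => hQ.1
  have hPneg : IsNeg P := by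
    intro i d x hd hx hdx q hq
    rw [Submodule.mem_sInf] at hq ⊢
    exact fun Q hQ => hQ.2 i d x hd hx hdx q (hq Q hQ)
  have hsign : ∀ q ∈ P, V.space.signOp 1 q ∈ P := by
    have : P ≤ P.comap (V.space.signOp 1) := by
      refine hPle _ ?_ ?_
      · rw [Submodule.mem_comap, V.space.signOp_apply 1 hwk]
        exact P.smul_mem _ hwP
      · intro i d x hd hx hdx q hq
        rw [Submodule.mem_comap, V.signOp_action 1 hx]
        exact P.smul_mem _ (hPneg i d x hd hx hdx _ hq)
    exact this
  have hstab : ∀ x : L, ∀ q ∈ P, V.action x q ∈ P := by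
    -- This replaces the PBW theorem. The vectors of `P` that all of `L` sends into `P` include `w`,
    -- and they are stable under negative `y` by `x y q = [x, y] q ± y x q`; minimality gives `P ≤
    -- R`.
    let R : Submodule ℂ V.carrier := P ⊓ ⨅ x : L, P.comap (V.action x)
    have hmemR : ∀ q, q ∈ R ↔ q ∈ P ∧ ∀ x, V.action x q ∈ P := fun q => by
      simp [R, Submodule.mem_iInf]
    have hR : P ≤ R := by
      refine hPle R ?_ ?_
      · refine (hmemR w).mpr ⟨hwP, fun x => ?_⟩
        have hx : x ∈ Submodule.span ℂ _ := hh.span_eq_top.symm ▸ Submodule.mem_top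
        induction hx using Submodule.span_induction with
        | zero => simp
        | add x y _ _ hx hy => simpa using P.add_mem hx hy
        | smul c x _ hx => simpa using P.smul_mem c hx
        | mem x hx =>
          obtain ⟨i, d, hx, hdx⟩ := hx
          rcases lt_trichotomy d 0 with hd | rfl | hd
          · exact hPneg i d x hd hx hdx w hwP
          · obtain ⟨c, hc⟩ := hw.2 x (by rw [hdx]; simp)
            rw [hc]
            exact P.smul_mem c hwP
          · rw [hw.1 i d x hd hx hdx]
            exact P.zero_mem
      · intro j e y he hy hey q hqR
        obtain ⟨hqP, hq⟩ := (hmemR q).mp hqR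
        refine (hmemR _).mpr ⟨hPneg j e y he hy hey q hqP, fun x => ?_⟩
        refine (LieSuperalgebra.space (L := L)).induction_homogeneous
          (P := fun x => V.action x (V.action y q) ∈ P) ?_ ?_ x
        · intro i x hx
          rw [V.action_action hx hy]
          exact P.add_mem (hq _) (P.smul_mem _ (hPneg j e y he hy hey _ (hq x)))
        · intro x x' hx hx'
          simpa using P.add_mem hx hx'
    intro x q hq
    exact ((hmemR q).mp (hR hq)).2 x
  rcases hV.2 P ((V.isSubmodule_iff P).mpr ⟨hsign, hstab⟩) with h0 | h1
  · rw [h0] at hwP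
    exact absurd hwP hw0
  · rw [eq_top_iff, ← h1]
    exact hPle Q hwQ hQ

/-- The weight space of a homogeneous singular vector in an irreducible module is a line. -/
theorem IsSingular.mem_span {V : SuperModule.{v} L} (hV : V.IsIrreducible) {h : L}
    (hh : IsRegular h) {w : V.carrier} (hw : V.IsSingular h w) (hw0 : w ≠ 0) {k : ZMod 2}
    (hwk : w ∈ V.space.part k) {μ : ℂ} (hμ : V.action h w = μ • w) {q : V.carrier}
    (hq : V.action h q = μ • q) : ∃ c : ℂ, q = c • w := by
  let E := Module.End.eigenspace (V.action h)
  -- `S` collects the weights `μ - 1, μ - 2, …`. Together with the line through `w` it is stable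
  -- under the negative part, hence everything, and it meets the weight space of `μ` only in zero.
  let S : Submodule ℂ V.carrier := ⨆ k : ℕ, E (μ - (k + 1))
  have hneg : ∀ (d : ℤ), d < 0 → ∃ k : ℕ, (d : ℂ) = -((k : ℂ) + 1) := by
    intro d hd
    refine ⟨(-d - 1).toNat, ?_⟩
    have : (((-d - 1).toNat : ℤ) : ℂ) = ((-d - 1 : ℤ) : ℂ) := by
      rw [Int.toNat_of_nonneg (by omega)]
    rw [Int.cast_natCast] at this
    rw [this]
    push_cast
    ring
  have htop : Submodule.span ℂ {w} ⊔ S = ⊤ := by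
    refine hw.eq_top hV hh hw0 hwk
      (Submodule.mem_sup_left (Submodule.mem_span_singleton_self w)) ?_
    intro i d x hd hx hdx q hq
    obtain ⟨k, hk⟩ := hneg d hd
    obtain ⟨a, ha, s, hs, rfl⟩ := Submodule.mem_sup.mp hq
    rw [map_add]
    refine Submodule.mem_sup_right (S.add_mem ?_ ?_)
    · obtain ⟨c, rfl⟩ := Submodule.mem_span_singleton.mp ha
      rw [map_smul]
      refine S.smul_mem c (Submodule.mem_iSup_of_mem k ?_)
      rw [Module.End.mem_eigenspace_iff, V.action_weight hh.even hx hdx hμ, hk, ← sub_eq_add_neg]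
    · have hS : S ≤ S.comap (V.action x) := by
        refine iSup_le fun l s hs => Submodule.mem_iSup_of_mem (l + k + 1) ?_
        rw [Module.End.mem_eigenspace_iff, V.action_weight hh.even hx hdx
          (Module.End.mem_eigenspace_iff.mp hs), hk]
        congr 1
        push_cast
        ring
      exact hS hs
  have hqtop : q ∈ Submodule.span ℂ {w} ⊔ S := htop ▸ Submodule.mem_top
  obtain ⟨a, ha, s, hs, rfl⟩ := Submodule.mem_sup.mp hqtop
  obtain ⟨c, rfl⟩ := Submodule.mem_span_singleton.mp ha
  refine ⟨c, ?_⟩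
  have hsμ : s ∈ E μ := by
    rw [Module.End.mem_eigenspace_iff]
    rw [map_add, map_smul, hμ, smul_add, smul_comm] at hq
    exact add_left_cancel hq
  have hdisj := Module.End.eigenspaces_iSupIndep (V.action h) μ
  have hle : S ≤ ⨆ (ν) (_ : ν ≠ μ), E ν := by
    refine iSup_le fun k => le_iSup₂_of_le (μ - (k + 1)) ?_ le_rfl
    intro hk
    have : (k : ℂ) + 1 = 0 := by linear_combination -hk
    exact Nat.cast_add_one_ne_zero k this
  rw [Submodule.disjoint_def.mp hdisj s hsμ (hle hs), add_zero]

/-- Irreducible modules stay irreducible when the grading is forgotten. -/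
theorem IsIrreducible.ungraded {V : SuperModule.{v} L} [FiniteDimensional ℂ V.carrier]
    (hV : V.IsIrreducible) {h : L} (hh : IsRegular h) (N : Submodule ℂ V.carrier)
    (hN : ∀ x : L, ∀ w ∈ N, V.action x w ∈ N) : N = ⊥ ∨ N = ⊤ := by
  by_cases hN0 : N = ⊥
  · exact Or.inl hN0
  right
  obtain ⟨w, hwN, hw0, hw⟩ := V.exists_isSingular hh hN0 hN
  obtain ⟨μ, hμ⟩ := hw.2 h (bracket_self_eq_zero hh.even)
  obtain ⟨k, hk⟩ : ∃ k, V.space.proj k w ≠ 0 := by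
    by_contra! hk
    apply hw0
    rw [← V.space.proj_zero_add_proj_one w, hk, hk, add_zero]
  have hs := hw.proj hh k
  have hμk : V.action h (V.space.proj k w) = μ • V.space.proj k w := by
    rw [SuperSpace.proj_eq_signOp, map_smul, map_add, map_smul, V.action_signOp hh.even, hμ,
      map_smul, superSign_zero_right]
    module
  -- The singular vector `w` of `N` has the same weight as its nonzero homogeneous component, so it
  -- is a multiple of that component. Hence the component lies in `N` and generates `V`.
  obtain ⟨c, hc⟩ := hs.mem_span hV hh hk (V.space.proj_mem k w) hμk hμ
  have hc0 : c ≠ 0 := by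
    rintro rfl
    exact hw0 (by rw [hc, zero_smul])
  refine hs.eq_top hV hh hk (V.space.proj_mem k w) ?_ fun i d x _ _ _ q hq => hN x q hq
  have : V.space.proj k w = c⁻¹ • w := by
    rw [eq_inv_smul_iff₀ hc0]
    exact hc.symm
  rw [this]
  exact N.smul_mem _ hwN

end SuperModule

/-! ### A regular element of the periplectic Lie superalgebra -/

section Periplectic

open LieSuperalgebra (part bracket IsRegular)

variable {n : ℕ}

theorem mem_periplectic_iff
    {M : Matrix (Fin (n + 1) ⊕ Fin (n + 1)) (Fin (n + 1) ⊕ Fin (n + 1)) ℂ} :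
    M ∈ periplectic n ↔ (∑ i, M (Sum.inl i) (Sum.inl i) = 0) ∧
      (∀ i j, M (Sum.inl j) (Sum.inr i) = M (Sum.inl i) (Sum.inr j)) ∧
      (∀ i j, M (Sum.inr j) (Sum.inl i) = -M (Sum.inr i) (Sum.inl j)) ∧
      ∀ i j, M (Sum.inr i) (Sum.inr j) = -M (Sum.inl j) (Sum.inl i) := by
  constructor
  · rintro ⟨X, Y, Z, hX, hY, hZ, rfl⟩
    refine ⟨hX, fun i j => ?_, fun i j => ?_, fun i j => rfl⟩
    · exact congrFun (congrFun hY i) j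
    · exact congrFun (congrFun hZ i) j
  · rintro ⟨hX, hY, hZ, hW⟩
    refine ⟨M.toBlocks₁₁, M.toBlocks₁₂, M.toBlocks₂₁, hX, ?_, ?_, ?_⟩
    · ext i j
      exact hY i j
    · ext i j
      exact hZ i j
    · ext (i | i) (j | j)
      · rfl
      · rfl
      · rfl
      · exact hW i j

variable (n) in
/-- Integers `d₀, …, dₙ` with sum zero. -/
def periplecticWeight (i : Fin (n + 1)) : ℤ :=
  -- The entries `2, 4, …, 2n` sum to `n(n + 1)`, which fixes the last entry; the factor `2` avoids
  -- a division.
  if i = Fin.last n then -(n * (n + 1)) else 2 * (i + 1)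

variable (n) in
/-- The weights `dᵢ` and `-dᵢ` of the two halves of the standard representation. -/
def periplecticDiag : Fin (n + 1) ⊕ Fin (n + 1) → ℤ :=
  Sum.elim (periplecticWeight n) (fun i => -periplecticWeight n i)

theorem sum_periplecticWeight : ∑ i, periplecticWeight n i = 0 := by
  rw [Fin.sum_univ_castSucc]
  have h : ∀ i : Fin n, periplecticWeight n i.castSucc = 2 * ((i : ℤ) + 1) := fun i => by
    simp [periplecticWeight, (Fin.castSucc_lt_last i).ne]
  have hsum : ∀ m : ℕ, ∑ i : Fin m, 2 * ((i : ℤ) + 1) = m * (m + 1) := by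
    intro m
    induction m with
    | zero => simp
    | succ m ih =>
      rw [Fin.sum_univ_castSucc]
      simp only [Fin.val_castSucc, ih, Fin.val_last]
      push_cast
      ring
  simp only [h, hsum]
  simp [periplecticWeight]

/-- The first `n` values are distinct, positive and at most `2n`, while the last has absolute value
`n(n + 1) ≥ 3n`. This is where `n ≥ 2` enters: for `n = 1` the values `2` and `-2` are opposite. -/
theorem periplecticDiag_injective (hn : 2 ≤ n) : Function.Injective (periplecticDiag n) := by
  have hs : (3 : ℤ) * n ≤ n * (n + 1) := by nlinarith
  have key : ∀ i j : Fin (n + 1), periplecticWeight n i + periplecticWeight n j ≠ 0 ∧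
      (periplecticWeight n i = periplecticWeight n j → i = j) := by
    intro i j
    have hi := i.2
    have hj := j.2
    simp only [periplecticWeight]
    generalize (n : ℤ) * (n + 1) = s at hs
    simp only [Fin.ext_iff, Fin.val_last]
    split_ifs <;> constructor <;> omega
  rintro (i | i) (j | j) h
  · exact congrArg _ ((key i j).2 h)
  · exact absurd (show _ + _ = (0 : ℤ) by simpa [periplecticDiag, eq_neg_iff_add_eq_zero] using h)
      (key i j).1
  · exact absurd (show _ + _ = (0 : ℤ) by
      simpa [periplecticDiag, neg_eq_iff_add_eq_zero] using h) (key i j).1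
  · exact congrArg _ ((key i j).2 (by simpa [periplecticDiag] using h))

/-- Multiplication of the matrix entries of weight `k` by `g k`. -/
def scaleWeights (g : ℤ → ℂ) (x : periplectic n) : periplectic n :=
  ⟨Matrix.of fun a b => g (periplecticDiag n a - periplecticDiag n b) * x.1 a b, by
    obtain ⟨h1, h2, h3, h4⟩ := mem_periplectic_iff.mp x.2
    refine mem_periplectic_iff.mpr ⟨?_, fun i j => ?_, fun i j => ?_, fun i j => ?_⟩
    · simp [← Finset.mul_sum, h1]
    · simp only [periplecticDiag, Matrix.of_apply, Sum.elim_inl, Sum.elim_inr]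
      rw [h2 i j, show periplecticWeight n j - -periplecticWeight n i =
        periplecticWeight n i - -periplecticWeight n j by ring]
    · simp only [periplecticDiag, Matrix.of_apply, Sum.elim_inl, Sum.elim_inr]
      rw [h3 i j, show -periplecticWeight n j - periplecticWeight n i =
        -periplecticWeight n i - periplecticWeight n j by ring, mul_neg]
    · simp only [periplecticDiag, Matrix.of_apply, Sum.elim_inl, Sum.elim_inr]
      rw [h4 i j, show -periplecticWeight n i - -periplecticWeight n j =
        periplecticWeight n j - periplecticWeight n i by ring, mul_neg]⟩

theorem scaleWeights_apply (g : ℤ → ℂ) (x : periplectic n) (a b) :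
    (scaleWeights g x).1 a b = g (periplecticDiag n a - periplecticDiag n b) * x.1 a b := rfl

theorem mem_periplecticPart_iff {i : ZMod 2} {x : periplectic n} :
    x ∈ part (periplectic n) i ↔ blockPart i x.1 = x.1 := by
  constructor
  · rintro ⟨M, hM⟩
    have hM' : blockPart i M = x.1 := hM
    rw [← hM', blockPart_blockPart, if_pos rfl]
  · intro h
    exact ⟨x.1, h⟩

theorem scaleWeights_mem (g : ℤ → ℂ) {i : ZMod 2} {x : periplectic n}
    (hx : x ∈ part (periplectic n) i) : scaleWeights g x ∈ part (periplectic n) i := by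
  rw [mem_periplecticPart_iff] at hx ⊢
  have h : ∀ a b, blockPart i (scaleWeights g x).1 a b =
      g (periplecticDiag n a - periplecticDiag n b) * blockPart i x.1 a b := by
    rcases zmod_two_cases i with rfl | rfl <;> rintro (a | a) (b | b) <;>
      simp [blockPart, Matrix.toBlocks₁₁, Matrix.toBlocks₁₂, Matrix.toBlocks₂₁,
        Matrix.toBlocks₂₂, scaleWeights]
  ext a b
  rw [h, hx, scaleWeights_apply]

variable (n) in
/-- The diagonal matrix with entries `dᵢ` and `-dᵢ`. -/
def periplecticElement : periplectic n :=
  ⟨Matrix.diagonal fun a => (periplecticDiag n a : ℂ), by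
    refine mem_periplectic_iff.mpr ⟨?_, fun i j => ?_, fun i j => ?_, fun i j => ?_⟩
    · simp only [Matrix.diagonal_apply_eq, periplecticDiag, Sum.elim_inl]
      exact_mod_cast sum_periplecticWeight
    · simp
    · simp
    · by_cases hij : i = j
      · subst hij
        simp [periplecticDiag]
      · rw [Matrix.diagonal_apply_ne _ (by simpa using hij),
          Matrix.diagonal_apply_ne _ (by simpa using Ne.symm hij), neg_zero]⟩

theorem blockPart_zero_diagonal (v : Fin (n + 1) ⊕ Fin (n + 1) → ℂ) :
    blockPart 0 (Matrix.diagonal v) = Matrix.diagonal v := by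
  ext (a | a) (b | b) <;> simp [blockPart, Matrix.toBlocks₁₁, Matrix.toBlocks₂₂]

/-- A commutator with a diagonal matrix multiplies each entry by a difference of diagonal entries.
Weight projections and the partial inverse of `ad h` are thus further instances of `scaleWeights`.
-/
theorem bracket_periplecticElement (x : periplectic n) :
    bracket (periplecticElement n) x = scaleWeights (fun k => (k : ℂ)) x := by
  apply Subtype.ext
  have h0 := blockPart_zero_diagonal (fun a => (periplecticDiag n a : ℂ))
  have h1 : blockPart 1 (Matrix.diagonal fun a => (periplecticDiag n a : ℂ)) = 0 := by
    rw [← h0, blockPart_blockPart]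
    simp
  have h : superCommutator (Matrix.diagonal fun a => (periplecticDiag n a : ℂ)) x.1 =
      Matrix.diagonal (fun a => (periplecticDiag n a : ℂ)) * x.1 -
        x.1 * Matrix.diagonal (fun a => (periplecticDiag n a : ℂ)) := by
    rw [superCommutator, LinearMap.mk₂_apply, h0, h1, sub_zero, ← add_mul, blockPart_zero_add_one]
  refine h.trans ?_
  ext a b
  rw [Matrix.sub_apply, Matrix.diagonal_mul, Matrix.mul_diagonal, scaleWeights_apply]
  push_cast
  ring

theorem eq_diagonal_of_bracket_eq_zero (hn : 2 ≤ n) {x : periplectic n}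
    (hx : bracket (periplecticElement n) x = 0) : x.1 = Matrix.diagonal fun a => x.1 a a := by
  rw [bracket_periplecticElement] at hx
  ext a b
  by_cases hab : a = b
  · subst hab
    simp
  · rw [Matrix.diagonal_apply_ne _ hab]
    have h : (scaleWeights (fun k => (k : ℂ)) x).1 a b = 0 := by rw [hx]; rfl
    rw [scaleWeights_apply] at h
    refine (mul_eq_zero.mp h).resolve_left ?_
    rw [← ne_eq, Int.cast_ne_zero, sub_ne_zero]
    exact fun h => hab (periplecticDiag_injective hn h)

/-- Because the diagonal entries of `h` are distinct, its centralizer consists of diagonal matrices,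
which are even and commute. Splitting the entries by weight diagonalizes `ad h` within each parity.
-/
theorem isRegular_periplecticElement (hn : 2 ≤ n) : IsRegular (periplecticElement n) where
  even := mem_periplecticPart_iff.mpr (blockPart_zero_diagonal _)
  span_eq_top := by
    rw [eq_top_iff]
    intro x _
    refine (LieSuperalgebra.space (L := periplectic n)).induction_homogeneous
      (P := fun x => x ∈ Submodule.span ℂ _) ?_ (fun x y hx hy => Submodule.add_mem _ hx hy) x
    intro i x hx
    let S : Finset ℤ := Finset.univ.image fun p : (Fin (n + 1) ⊕ Fin (n + 1)) ×
      (Fin (n + 1) ⊕ Fin (n + 1)) => periplecticDiag n p.1 - periplecticDiag n p.2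
    have hsum : x = ∑ d ∈ S, scaleWeights (fun k => if k = d then 1 else 0) x := by
      apply Subtype.ext
      ext a b
      rw [AddSubmonoidClass.coe_finsetSum, Matrix.sum_apply]
      simp only [scaleWeights_apply, ite_mul, one_mul, zero_mul]
      rw [Finset.sum_ite_eq, if_pos]
      exact Finset.mem_image.mpr ⟨(a, b), Finset.mem_univ _, rfl⟩
    rw [hsum]
    refine Submodule.sum_mem _ fun d _ => Submodule.subset_span ⟨i, d, scaleWeights_mem _ hx, ?_⟩
    rw [bracket_periplecticElement]
    apply Subtype.ext
    ext a b
    change _ = (d : ℂ) * _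
    simp only [scaleWeights_apply]
    split_ifs with h
    · rw [h]
    · simp
  centralizer_even x hx := by
    rw [mem_periplecticPart_iff, eq_diagonal_of_bracket_eq_zero hn hx]
    exact blockPart_zero_diagonal _
  centralizer_abelian x y hx hy := by
    have hx' := eq_diagonal_of_bracket_eq_zero hn hx
    have hy' := eq_diagonal_of_bracket_eq_zero hn hy
    apply Subtype.ext
    change superCommutator x.1 y.1 = 0
    rw [hx', hy', superCommutator_apply (i := 0) (j := 0) ⟨_, blockPart_zero_diagonal _⟩
      ⟨_, blockPart_zero_diagonal _⟩, Matrix.diagonal_mul_diagonal, Matrix.diagonal_mul_diagonal]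
    simp [mul_comm]

/-! ### Spanning `p(n)` by brackets with even elements -/

/-- The even element `(X 0; 0 -Xᵀ)`. -/
def periplecticEven (X : Matrix (Fin (n + 1)) (Fin (n + 1)) ℂ) (hX : X.trace = 0) :
    periplectic n :=
  ⟨Matrix.fromBlocks X 0 0 (-X.transpose), X, 0, 0, hX, by simp, by simp, rfl⟩

theorem periplecticEven_mem (X : Matrix (Fin (n + 1)) (Fin (n + 1)) ℂ) (hX : X.trace = 0) :
    periplecticEven X hX ∈ part (periplectic n) 0 :=
  mem_periplecticPart_iff.mpr (by simp [periplecticEven, blockPart])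

theorem bracket_periplecticEven {X Y : Matrix (Fin (n + 1)) (Fin (n + 1)) ℂ} (hX : X.trace = 0)
    (hY : Y.trace = 0) :
    (bracket (periplecticEven X hX) (periplecticEven Y hY)).1 =
      Matrix.fromBlocks (X * Y - Y * X) 0 0 (-(X * Y - Y * X).transpose) := by
  refine (superCommutator_apply (periplecticEven_mem X hX) (periplecticEven_mem Y hY)).trans ?_
  simp [periplecticEven, Matrix.fromBlocks_multiply, sub_eq_add_neg, Matrix.fromBlocks_neg,
    Matrix.fromBlocks_add, add_comm]

theorem periplectic_even_ext {x y : periplectic n} (hx : x ∈ part (periplectic n) 0)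
    (hy : y ∈ part (periplectic n) 0)
    (h : ∀ a b, x.1 (Sum.inl a) (Sum.inl b) = y.1 (Sum.inl a) (Sum.inl b)) : x = y := by
  rw [mem_periplecticPart_iff] at hx hy
  apply Subtype.ext
  ext (a | a) (b | b)
  · exact h a b
  · rw [← hx, ← hy]
    simp [blockPart]
  · rw [← hx, ← hy]
    simp [blockPart]
  · rw [(mem_periplectic_iff.mp x.2).2.2.2, (mem_periplectic_iff.mp y.2).2.2.2, h]

theorem bracket_mem_even {y z : periplectic n} (hy : y ∈ part (periplectic n) 0)
    (hz : z ∈ part (periplectic n) 0) : bracket y z ∈ part (periplectic n) 0 := by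
  have h := LieSuperalgebra.bracket_mem hy hz
  rwa [add_zero] at h

theorem trace_single_castSucc_last (i : Fin n) :
    (Matrix.single i.castSucc (Fin.last n) (1 : ℂ)).trace = 0 :=
  Matrix.trace_single_eq_of_ne _ _ _ (Fin.castSucc_lt_last i).ne

theorem trace_single_last_castSucc (i : Fin n) :
    (Matrix.single (Fin.last n) i.castSucc (1 : ℂ)).trace = 0 :=
  Matrix.trace_single_eq_of_ne _ _ _ (Fin.castSucc_lt_last i).ne'

/-- On upper left blocks the brackets are `[E_{in}, E_{ni}] = E_{ii} - E_{nn}`. The first `n`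
diagonal entries serve as coefficients, and tracelessness gives the last entry. -/
theorem eq_sum_bracket_of_diagonal {x : periplectic n} (hx : x ∈ part (periplectic n) 0)
    (hdiag : x.1 = Matrix.diagonal fun a => x.1 a a) :
    x = ∑ i : Fin n, x.1 (Sum.inl i.castSucc) (Sum.inl i.castSucc) •
      bracket (periplecticEven _ (trace_single_castSucc_last i))
        (periplecticEven _ (trace_single_last_castSucc i)) := by
  refine periplectic_even_ext hx (Submodule.sum_mem _ fun i _ => Submodule.smul_mem _ _
    (bracket_mem_even (periplecticEven_mem _ _) (periplecticEven_mem _ _))) fun a b => ?_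
  rw [AddSubmonoidClass.coe_finsetSum, Matrix.sum_apply]
  have hterm : ∀ i : Fin n, (x.1 (Sum.inl i.castSucc) (Sum.inl i.castSucc) •
      bracket (periplecticEven _ (trace_single_castSucc_last i))
        (periplecticEven _ (trace_single_last_castSucc i))).1 (Sum.inl a) (Sum.inl b) =
      x.1 (Sum.inl i.castSucc) (Sum.inl i.castSucc) *
        (Matrix.single i.castSucc i.castSucc (1 : ℂ) a b -
          Matrix.single (Fin.last n) (Fin.last n) (1 : ℂ) a b) := by
    intro i
    rw [Submodule.coe_smul, Matrix.smul_apply, bracket_periplecticEven, Matrix.fromBlocks_apply₁₁,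
      Matrix.single_mul_single_same, Matrix.single_mul_single_same, Matrix.sub_apply, mul_one,
      smul_eq_mul]
  rw [Finset.sum_congr rfl fun i _ => hterm i]
  by_cases hab : a = b
  · subst hab
    induction a using Fin.lastCases with
    | last =>
      have h1 := (mem_periplectic_iff.mp x.2).1
      rw [Fin.sum_univ_castSucc] at h1
      rw [eq_neg_of_add_eq_zero_right h1, ← Finset.sum_neg_distrib]
      refine Finset.sum_congr rfl fun i _ => ?_
      simp [(Fin.castSucc_lt_last _).ne]
    | cast j =>
      simp [Matrix.single_apply, (Fin.castSucc_lt_last _).ne']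
  · rw [hdiag, Matrix.diagonal_apply_ne _ (by simpa using hab)]
    refine (Finset.sum_eq_zero fun i _ => ?_).symm
    rw [Matrix.single_apply_of_ne, Matrix.single_apply_of_ne]
    · simp
    · rintro ⟨rfl, h⟩
      exact hab h
    · rintro ⟨rfl, h⟩
      exact hab h

/-- Each homogeneous component of `p(n)` is spanned by brackets with even elements. -/
theorem periplectic_part_le_span (hn : 2 ≤ n) (i : ZMod 2) :
    part (periplectic n) i ≤ Submodule.span ℂ {x | ∃ y ∈ part (periplectic n) 0,
      ∃ z ∈ part (periplectic n) i, bracket y z = x} := by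
  intro x hx
  have hreg := isRegular_periplecticElement hn
  -- On nonzero weights `ad h` is invertible, so that part of `x` is a bracket with `h`; only the
  -- weight zero part remains.
  have hsum : x = bracket (periplecticElement n) (scaleWeights (fun k => (k : ℂ)⁻¹) x) +
      scaleWeights (fun k => if k = 0 then 1 else 0) x := by
    rw [bracket_periplecticElement]
    apply Subtype.ext
    ext a b
    rw [Submodule.coe_add, Matrix.add_apply]
    simp only [scaleWeights_apply]
    split_ifs with h
    · simp [h]
    · rw [← mul_assoc, mul_inv_cancel₀ (by exact_mod_cast h)]
      simp
  rw [hsum]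
  refine Submodule.add_mem _ (Submodule.subset_span ⟨_, hreg.even, _, scaleWeights_mem _ hx, rfl⟩) ?_
  set x₀ := scaleWeights (fun k => if k = 0 then 1 else 0) x with hx₀
  have hx₀i : x₀ ∈ part (periplectic n) i := scaleWeights_mem _ hx
  have hcent : bracket (periplecticElement n) x₀ = 0 := by
    rw [bracket_periplecticElement]
    apply Subtype.ext
    ext a b
    change _ = (0 : ℂ)
    simp only [hx₀, scaleWeights_apply]
    split_ifs with h
    · simp [h]
    · simp
  rcases zmod_two_cases i with rfl | rfl
  · have hdiag := eq_diagonal_of_bracket_eq_zero hn hcent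
    have hx₀sum := eq_sum_bracket_of_diagonal hx₀i hdiag
    rw [hx₀sum]
    exact Submodule.sum_mem _ fun i _ => Submodule.smul_mem _ _ (Submodule.subset_span
      ⟨_, periplecticEven_mem _ _, _, periplecticEven_mem _ _, rfl⟩)
  -- The centralizer of `h` is even, so an odd element of weight zero vanishes.
  · have h0 : x₀ = 0 := (Submodule.disjoint_def.mp
      (LieSuperalgebra.space (L := periplectic n)).isCompl.disjoint) x₀
        (hreg.centralizer_even x₀ hcent) hx₀i
    rw [h0]
    exact Submodule.zero_mem _

end Periplectic

/-! ### The vanishing ideal of a module over a map superalgebra -/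

namespace SuperModule

open LieSuperalgebra (part bracket)

variable {L : Type*} [AddCommGroup L] [Module ℂ L] [LieSuperalgebra L]
  {A : Type*} [CommRing A] [Algebra ℂ A]

theorem tmul_mem_part {i : ZMod 2} {x : L} (hx : x ∈ part L i) (a : A) :
    x ⊗ₜ[ℂ] a ∈ part (L ⊗[ℂ] A) i :=
  Submodule.subset_span ⟨x, hx, a, rfl⟩

theorem bracket_tmul (x y : L) (a b : A) :
    bracket (x ⊗ₜ[ℂ] a) (y ⊗ₜ[ℂ] b) = bracket x y ⊗ₜ[ℂ] (a * b) := rfl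

theorem action_tmul_action_tmul (V : SuperModule.{v} (L ⊗[ℂ] A)) {i j : ZMod 2} {x y : L}
    (hx : x ∈ part L i) (hy : y ∈ part L j) (a b : A) (w : V.carrier) :
    V.action (x ⊗ₜ a) (V.action (y ⊗ₜ b) w) = V.action (bracket x y ⊗ₜ (a * b)) w +
      superSign i j • V.action (y ⊗ₜ b) (V.action (x ⊗ₜ a) w) :=
  V.action_action (tmul_mem_part hx a) (tmul_mem_part hy b) w

theorem action_tmul_eq_zero_of_homogeneous (V : SuperModule.{v} (L ⊗[ℂ] A)) {a : A} {w : V.carrier}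
    (h : ∀ i, ∀ x ∈ part L i, V.action (x ⊗ₜ a) w = 0) (x : L) : V.action (x ⊗ₜ a) w = 0 :=
  (LieSuperalgebra.space (L := L)).induction_homogeneous
    (P := fun x => V.action (x ⊗ₜ a) w = 0) h
    (fun x y hx hy => by rw [TensorProduct.add_tmul, map_add, LinearMap.add_apply, hx, hy, add_zero])
    x

/-- Each homogeneous component is spanned by brackets with even elements. -/
def PerfectlyGraded (L : Type*) [AddCommGroup L] [Module ℂ L] [LieSuperalgebra L] : Prop :=
  ∀ i, part L i ≤ Submodule.span ℂ {x | ∃ y ∈ part L 0, ∃ z ∈ part L i, bracket y z = x}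

theorem action_tmul_eq_zero_of_bracket (hL : PerfectlyGraded L) (V : SuperModule.{v} (L ⊗[ℂ] A))
    {a : A} {w : V.carrier} {i : ZMod 2}
    (h : ∀ y ∈ part L 0, ∀ z ∈ part L i, V.action (bracket y z ⊗ₜ a) w = 0) {x : L}
    (hx : x ∈ part L i) : V.action (x ⊗ₜ a) w = 0 := by
  have hspan := hL i hx
  clear hx
  induction hspan using Submodule.span_induction with
  | zero => rw [TensorProduct.zero_tmul, map_zero, LinearMap.zero_apply]
  | add x y _ _ hx hy =>
    rw [TensorProduct.add_tmul, map_add, LinearMap.add_apply, hx, hy, add_zero]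
  | smul c x _ hx =>
    rw [← TensorProduct.smul_tmul', map_smul, LinearMap.smul_apply, hx, smul_zero]
  | mem x hx =>
    obtain ⟨y, hy, z, hz, rfl⟩ := hx
    exact h y hy z hz

/-- The ideal of all `a` such that `L ⊗ a` acts by zero. -/
def vanishingIdeal (hL : PerfectlyGraded L) (V : SuperModule.{v} (L ⊗[ℂ] A)) : Ideal A where
  carrier := {a | ∀ (x : L) (w : V.carrier), V.action (x ⊗ₜ a) w = 0}
  zero_mem' x w := by rw [TensorProduct.tmul_zero, map_zero, LinearMap.zero_apply]
  add_mem' {a b} ha hb x w := by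
    rw [TensorProduct.tmul_add, map_add, LinearMap.add_apply, ha, hb, add_zero]
  smul_mem' b a ha x w := by
    refine V.action_tmul_eq_zero_of_homogeneous (fun i x hx => ?_) x
    refine V.action_tmul_eq_zero_of_bracket hL (fun y hy z hz => ?_) hx
    -- After reduction to brackets, `[y, z] ⊗ ba = [y ⊗ b, z ⊗ a]`, and both terms of the
    -- supercommutator contain `z ⊗ a`.
    have h := V.action_tmul_action_tmul hy hz b a w
    rw [ha z, ha z, map_zero, smul_zero, add_zero] at h
    exact h.symm

theorem mem_vanishingIdeal {hL : PerfectlyGraded L} {V : SuperModule.{v} (L ⊗[ℂ] A)} {a : A} :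
    a ∈ vanishingIdeal hL V ↔ ∀ (x : L) (w : V.carrier), V.action (x ⊗ₜ a) w = 0 := Iff.rfl

/-- The ideal is the kernel of the linear map from `A` to the finite-dimensional space `Hom(L, End
V)`. -/
theorem finiteDimensional_quotient_vanishingIdeal [FiniteDimensional ℂ L] (hL : PerfectlyGraded L)
    (V : SuperModule.{v} (L ⊗[ℂ] A)) [FiniteDimensional ℂ V.carrier] :
    FiniteDimensional ℂ (A ⧸ vanishingIdeal hL V) := by
  let F : A →ₗ[ℂ] L →ₗ[ℂ] Module.End ℂ V.carrier :=
    (TensorProduct.mk ℂ L A).flip.compr₂ V.action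
  have hker : LinearMap.ker F = (vanishingIdeal hL V).restrictScalars ℂ := by
    ext a
    rw [LinearMap.mem_ker, Submodule.restrictScalars_mem, mem_vanishingIdeal, LinearMap.ext_iff]
    exact forall_congr' fun x => LinearMap.ext_iff
  have hfin : FiniteDimensional ℂ (A ⧸ (vanishingIdeal hL V).restrictScalars ℂ) := by
    rw [← hker]
    exact Module.Finite.equiv F.quotKerEquivRange.symm
  exact hfin

/-- For `a²` in the ideal, `L ⊗ aA` acts by supercommuting operators. A spanning set of them is
nilpotent, so there is a common null vector, and the null space of `L ⊗ aA` is a nonzero submodule.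
-/
theorem vanishingIdeal_isRadical (hL : PerfectlyGraded L) (V : SuperModule.{v} (L ⊗[ℂ] A))
    [FiniteDimensional ℂ V.carrier] (hV : V.IsIrreducible) : (vanishingIdeal hL V).IsRadical := by
  rw [Ideal.isRadical_iff_pow_one_lt 2 one_lt_two]
  intro a ha
  have := hV.1
  have hsq : ∀ (x : L) (b c : A) (w : V.carrier), V.action (x ⊗ₜ (a * b * (a * c))) w = 0 := by
    intro x b c w
    have : a * b * (a * c) ∈ vanishingIdeal hL V := by
      rw [show a * b * (a * c) = b * c * a ^ 2 by ring]
      exact Ideal.mul_mem_left _ _ ha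
    exact mem_vanishingIdeal.mp this x w
  have hcomm : ∀ {i j : ZMod 2} {x y : L}, x ∈ part L i → y ∈ part L j → ∀ (b c : A) (w : V.carrier),
      V.action (x ⊗ₜ (a * b)) (V.action (y ⊗ₜ (a * c)) w) =
        superSign i j • V.action (y ⊗ₜ (a * c)) (V.action (x ⊗ₜ (a * b)) w) := by
    intro i j x y hx hy b c w
    rw [V.action_tmul_action_tmul hx hy, hsq, zero_add]
  have heven : ∀ {y z : L}, y ∈ part L 0 → z ∈ part L 0 → bracket y z ∈ part L 0 := by
    intro y z hy hz
    have h := LieSuperalgebra.bracket_mem hy hz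
    rwa [add_zero] at h
  let S : Set (Module.End ℂ V.carrier) :=
    {s | (∃ y ∈ part L 0, ∃ z ∈ part L 0, ∃ b : A, V.action (bracket y z ⊗ₜ (a * b)) = s) ∨
      ∃ x ∈ part L 1, ∃ b : A, V.action (x ⊗ₜ (a * b)) = s}
  have hS : ∀ s ∈ S, ∃ (i : ZMod 2) (x : L), x ∈ part L i ∧
      ∃ b : A, V.action (x ⊗ₜ (a * b)) = s := by
    rintro s (⟨y, hy, z, hz, b, rfl⟩ | ⟨x, hx, b, rfl⟩)
    · exact ⟨0, _, heven hy hz, b, rfl⟩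
    · exact ⟨1, x, hx, b, rfl⟩
  obtain ⟨w, hw0, hw⟩ := exists_common_null_vector S
    (by
      rintro s (⟨y, hy, z, hz, b, rfl⟩ | ⟨x, hx, b, rfl⟩)
      -- Only brackets are known to be nilpotent: `[y, z] ⊗ ab` is the commutator of `y ⊗ 1` and `z
      -- ⊗ ab`, and it commutes with the latter since both lie in `L ⊗ aA`.
      · refine isNilpotent_of_commutator (x := V.action (y ⊗ₜ 1)) (z := V.action (z ⊗ₜ (a * b)))
          ?_ ?_
        · ext w
          have h := V.action_tmul_action_tmul hy hz 1 (a * b) w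
          rw [one_mul, superSign_zero_left, one_smul] at h
          rw [LinearMap.sub_apply, Module.End.mul_apply, Module.End.mul_apply, h, add_sub_cancel_right]
        · refine LinearMap.ext fun w => ?_
          have h := hcomm (heven hy hz) hz b b w
          rwa [superSign_zero_left, one_smul] at h
      -- An odd operator supercommuting with itself satisfies `s² = -s²`.
      · refine ⟨2, LinearMap.ext fun w => ?_⟩
        have h := hcomm hx hx b b w
        rw [superSign_one_one, neg_one_smul] at h
        have h2 : (2 : ℂ) • V.action (x ⊗ₜ (a * b)) (V.action (x ⊗ₜ (a * b)) w) = 0 := by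
          rw [two_smul]
          nth_rewrite 1 [h]
          exact neg_add_cancel _
        rw [pow_two]
        exact (smul_eq_zero.mp h2).resolve_left two_ne_zero)
    (by
      intro s hs t ht
      obtain ⟨i, x, hx, b, rfl⟩ := hS s hs
      obtain ⟨j, y, hy, c, rfl⟩ := hS t ht
      exact ⟨superSign i j, LinearMap.ext fun w => hcomm hx hy b c w⟩)
  let K : Submodule ℂ V.carrier :=
    { carrier := {w | ∀ (x : L) (b : A), V.action (x ⊗ₜ (a * b)) w = 0}
      zero_mem' := fun x b => map_zero _
      add_mem' := fun {v w} hv hw x b => by rw [map_add, hv, hw, add_zero]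
      smul_mem' := fun c w hw x b => by rw [map_smul, hw, smul_zero] }
  have hwK : w ∈ K := by
    intro x b
    refine V.action_tmul_eq_zero_of_homogeneous (fun i x hx => ?_) x
    rcases zmod_two_cases i with rfl | rfl
    · exact V.action_tmul_eq_zero_of_bracket hL
        (fun y hy z hz => hw _ (Or.inl ⟨y, hy, z, hz, b, rfl⟩)) hx
    · exact hw _ (Or.inr ⟨x, hx, b, rfl⟩)
  have hK : V.IsSubmodule K := by
    rw [isSubmodule_iff]
    constructor
    · intro w hw x b
      refine V.action_tmul_eq_zero_of_homogeneous (fun i x hx => ?_) x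
      rw [V.action_signOp (tmul_mem_part hx _), hw x b, map_zero, smul_zero]
    · intro t w hw
      induction t with
      | zero => rw [map_zero]; exact K.zero_mem
      | add s t hs ht => rw [map_add]; exact K.add_mem hs ht
      | tmul y c =>
        refine (LieSuperalgebra.space (L := L)).induction_homogeneous
          (P := fun y => V.action (y ⊗ₜ c) w ∈ K) (fun j y hy => ?_) (fun y y' h h' => ?_) y
        · intro x b
          refine V.action_tmul_eq_zero_of_homogeneous (fun i x hx => ?_) x
          -- The bracket of `x ⊗ ab` with `y ⊗ c` stays in `L ⊗ aA`, so it kills `w` too.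
          rw [V.action_tmul_action_tmul hx hy, hw x b, map_zero, smul_zero, add_zero, mul_assoc]
          exact hw _ _
        · rw [TensorProduct.add_tmul, map_add]
          exact K.add_mem h h'
  rw [mem_vanishingIdeal]
  intro x w'
  have hw' : w' ∈ K := by
    rcases hV.2 K hK with h | h
    · rw [h] at hwK
      exact absurd hwK hw0
    · rw [h]
      trivial
  have h := hw' x 1
  rwa [mul_one] at h

end SuperModule

/-! ### Maximal ideals above a radical ideal -/

/-- A radical ideal of finite codimension contains a nonempty finite intersection of maximal
ideals. -/
theorem exists_maximalSpectrum_family {A : Type*} [CommRing A] [Nontrivial A] [Algebra ℂ A]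
    [Algebra.FiniteType ℂ A] (I : Ideal A) (hI : I.IsRadical) [FiniteDimensional ℂ (A ⧸ I)] :
    ∃ (ℓ : ℕ) (m : Fin (ℓ + 1) → MaximalSpectrum A), Function.Injective m ∧
      ∀ a, (∀ i, a ∈ (m i).asIdeal) → a ∈ I := by
  classical
  have : IsArtinianRing (A ⧸ I) := IsArtinianRing.of_finite ℂ (A ⧸ I)
  have : IsJacobsonRing A := isJacobsonRing_of_finiteType (A := ℂ)
  let S : Set (MaximalSpectrum A) := {m | I ≤ m.asIdeal}
  -- The maximal ideals above `I` inject into those of the Artinian ring `A / I`, which are finitely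
  -- many.
  have hfin : S.Finite := by
    let f : MaximalSpectrum A → Ideal (A ⧸ I) := fun m => m.asIdeal.map (Ideal.Quotient.mk I)
    have hinj : Set.InjOn f S := by
      intro m hm m' hm' h
      have h' := congrArg (Ideal.comap (Ideal.Quotient.mk I)) h
      simp only [f] at h'
      rw [Ideal.comap_map_mk hm, Ideal.comap_map_mk hm'] at h'
      exact MaximalSpectrum.ext h'
    refine Set.Finite.of_finite_image ((Set.finite_range
      (MaximalSpectrum.asIdeal (R := A ⧸ I))).subset ?_) hinj
    rintro _ ⟨m, hm, rfl⟩
    have := m.isMaximal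
    rcases Ideal.map_eq_top_or_isMaximal_of_surjective (Ideal.Quotient.mk I)
      Ideal.Quotient.mk_surjective m.isMaximal with h | h
    · exfalso
      have h' := congrArg (Ideal.comap (Ideal.Quotient.mk I)) h
      rw [Ideal.comap_map_mk hm, Ideal.comap_top] at h'
      exact m.isMaximal.ne_top h'
    · exact ⟨⟨_, h⟩, rfl⟩
  -- An arbitrary maximal ideal is added so that the family is nonempty even for `I = A`, the case
  -- of zero action; enlarging the family only shrinks the intersection.
  obtain ⟨m₀, hm₀⟩ := Ideal.exists_maximal A
  let T : Finset (MaximalSpectrum A) := insert ⟨m₀, hm₀⟩ hfin.toFinset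
  obtain ⟨ℓ, hℓ⟩ : ∃ ℓ, T.card = ℓ + 1 :=
    Nat.exists_eq_succ_of_ne_zero (Finset.card_ne_zero_of_mem (Finset.mem_insert_self _ _))
  refine ⟨ℓ, fun i => ((T.equivFinOfCardEq hℓ).symm i).1,
    Subtype.val_injective.comp (T.equivFinOfCardEq hℓ).symm.injective, fun a ha => ?_⟩
  have hrad : I = I.jacobson := by rw [← Ideal.radical_eq_jacobson, hI.radical]
  rw [hrad, Ideal.jacobson, Submodule.mem_sInf]
  rintro J ⟨hIJ, hJ⟩
  have hmem : (⟨J, hJ⟩ : MaximalSpectrum A) ∈ T :=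
    Finset.mem_insert_of_mem (hfin.mem_toFinset.mpr hIJ)
  have h := ha (T.equivFinOfCardEq hℓ ⟨_, hmem⟩)
  simpa using h

/-! ### Tensor products of evaluation modules -/

section Evaluation

variable {A : Type*} [CommRing A] [Algebra ℂ A] [Algebra.FiniteType ℂ A]

/-- Modulo `m` every coefficient is a scalar, which is what lets an action killed by `m` factor
through evaluation. -/
theorem sub_algebraMap_residueMap_mem (m : MaximalSpectrum A) (a : A) :
    a - algebraMap ℂ A (residueMap m a) ∈ m.asIdeal := by
  rw [← Ideal.Quotient.eq_zero_iff_mem]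
  apply (residueEquiv m).injective
  have h : residueMap m (a - algebraMap ℂ A (residueMap m a)) = 0 := by
    rw [map_sub, AlgHom.commutes, Algebra.algebraMap_self_apply, sub_self]
  rw [map_zero]
  exact h

end Evaluation

namespace SuperModule

open LieSuperalgebra (part bracket IsRegular)

variable {L : Type*} [AddCommGroup L] [Module ℂ L] [LieSuperalgebra L]
  {A : Type*} [CommRing A] [Algebra ℂ A]

theorem map_mem_of_mem_tensorPart {P Q Z : Type*} [AddCommGroup P] [Module ℂ P] [AddCommGroup Q]
    [Module ℂ Q] [AddCommGroup Z] [Module ℂ Z] {S : SuperSpace P} {T : SuperSpace Q} {k : ZMod 2}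
    (F : P ⊗[ℂ] Q →ₗ[ℂ] Z) (N : Submodule ℂ Z)
    (h : ∀ i j, i + j = k → ∀ p ∈ S.part i, ∀ q ∈ T.part j, F (p ⊗ₜ q) ∈ N) {t : P ⊗[ℂ] Q}
    (ht : t ∈ SuperSpace.tensorPart S T k) : F t ∈ N := by
  have hle : SuperSpace.tensorPart S T k ≤ N.comap F := by
    refine Submodule.span_le.mpr ?_
    rintro _ ⟨i, j, hij, p, hp, q, hq, rfl⟩
    exact h i j hij p hp q hq
  exact hle ht

/-- Tensoring an isomorphism with a module. -/
def Iso.tensorLeft (P : SuperModule.{v} L) {Q Q' : SuperModule.{v} L} (e : Iso Q Q') :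
    Iso (tensor P Q) (tensor P Q') where
  toLinearEquiv := e.toLinearEquiv.lTensor P.carrier
  map_mem ht := map_mem_of_mem_tensorPart (e.toLinearEquiv.lTensor P.carrier).toLinearMap _
    (fun _ _ hij _ hp _ hq => SuperSpace.tmul_mem_tensorPart _ _ hij hp (e.map_mem hq)) ht
  map_action x t := by
    refine tensorAction_induction P Q (e.toLinearEquiv.lTensor P.carrier).toLinearMap
      (tensorAction P Q') (fun {i j y p} q hy hp => ?_) x t
    simp only [LinearEquiv.coe_coe, LinearEquiv.lTensor_tmul, e.map_action]
    rw [tensorAction_tmul _ _ hy hp]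

/-- The isomorphism `P ⊗ ℂ ≅ P` of vector spaces. -/
def ridULift (P : Type v) [AddCommGroup P] [Module ℂ P] : P ⊗[ℂ] ULift.{v} ℂ ≃ₗ[ℂ] P :=
  (ULift.moduleEquiv.lTensor P).trans (TensorProduct.rid ℂ P)

theorem ridULift_tmul {P : Type v} [AddCommGroup P] [Module ℂ P] (p : P) (q : ULift.{v} ℂ) :
    ridULift P (p ⊗ₜ q) = q.down • p := rfl

/-- Tensoring with the trivial module. -/
def tensorTrivialIso (P : SuperModule.{v} L) : Iso (tensor P (trivial L)) P where
  toLinearEquiv := ridULift P.carrier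
  map_mem {i t} ht := by
    refine map_mem_of_mem_tensorPart (S := P.space) (T := SuperSpace.purelyEven (ULift.{v} ℂ))
      (ridULift P.carrier).toLinearMap (P.space.part i) (fun j k hjk p hp q hq => ?_) ht
    rw [LinearEquiv.coe_coe, ridULift_tmul]
    rcases zmod_two_cases k with rfl | rfl
    · rw [← hjk, add_zero]
      exact Submodule.smul_mem _ _ hp
    · have hq0 : q = 0 := by simpa [SuperSpace.purelyEven] using hq
      rw [hq0, ULift.zero_down, zero_smul]
      exact Submodule.zero_mem _
  map_action x t := by
    have key : ∀ (s : ℂ) (y : L) (p : P.carrier) (q : ULift.{v} ℂ),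
        ridULift P.carrier (P.action y p ⊗ₜ q) + s • ridULift P.carrier (p ⊗ₜ 0) =
          P.action y (ridULift P.carrier (p ⊗ₜ q)) := by
      intro s y p q
      simp [ridULift_tmul]
    exact tensorAction_induction P (trivial L) (ridULift P.carrier).toLinearMap
      P.action (fun {i j y p} q _ _ => key (superSign i j) y p q) x t

/-! ### Splitting the action by an idempotent -/

variable (L) in
/-- Multiplication by `c ∈ A` on `L ⊗ A`. -/
def mulCoeff (c : A) : L ⊗[ℂ] A →ₗ[ℂ] L ⊗[ℂ] A := (LinearMap.mulLeft ℂ c).lTensor L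

set_option linter.unusedSectionVars false in
theorem mulCoeff_tmul (c : A) (x : L) (a : A) : mulCoeff L c (x ⊗ₜ a) = x ⊗ₜ (c * a) := rfl

theorem mulCoeff_mem {c : A} {i : ZMod 2} {t : L ⊗[ℂ] A} (ht : t ∈ part (L ⊗[ℂ] A) i) :
    mulCoeff L c t ∈ part (L ⊗[ℂ] A) i := by
  change t ∈ mapPart L A i at ht
  change _ ∈ mapPart L A i
  induction ht using Submodule.span_induction with
  | zero => rw [map_zero]; exact Submodule.zero_mem _
  | add s t _ _ hs ht => rw [map_add]; exact Submodule.add_mem _ hs ht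
  | smul c t _ ht => rw [map_smul]; exact Submodule.smul_mem _ _ ht
  | mem t ht =>
    obtain ⟨x, hx, a, rfl⟩ := ht
    exact tmul_mem_part hx _

theorem bracket_mulCoeff (c d : A) (s t : L ⊗[ℂ] A) :
    bracket (mulCoeff L c s) (mulCoeff L d t) = mulCoeff L (c * d) (bracket s t) := by
  induction s with
  | zero => simp
  | add s s' hs hs' => simp only [map_add, LinearMap.add_apply, hs, hs']
  | tmul x a =>
    induction t with
    | zero => simp
    | add t t' ht ht' => simp only [map_add, ht, ht']
    | tmul y b =>
      rw [mulCoeff_tmul, mulCoeff_tmul, bracket_tmul, bracket_tmul, mulCoeff_tmul,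
        mul_mul_mul_comm]

/-- `L ⊗ I` acts by zero. -/
def KilledBy (V : SuperModule.{v} (L ⊗[ℂ] A)) (I : Ideal A) : Prop :=
  ∀ a ∈ I, ∀ (x : L) (w : V.carrier), V.action (x ⊗ₜ a) w = 0

theorem KilledBy.action_mulCoeff {V : SuperModule.{v} (L ⊗[ℂ] A)} {I : Ideal A}
    (hI : V.KilledBy I) {c : A} (hc : c ∈ I) (t : L ⊗[ℂ] A) (w : V.carrier) :
    V.action (mulCoeff L c t) w = 0 := by
  induction t with
  | zero => simp
  | add s t hs ht => rw [map_add, map_add, LinearMap.add_apply, hs, ht, add_zero]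
  | tmul x a => exact hI _ (I.mul_mem_right a hc) x w

/-- Lets identities of idempotents that hold only modulo `I` be used as identities of operators. -/
theorem KilledBy.action_congr {V : SuperModule.{v} (L ⊗[ℂ] A)} {I : Ideal A}
    (hI : V.KilledBy I) {c d : A} (hcd : c - d ∈ I) (t : L ⊗[ℂ] A) (w : V.carrier) :
    V.action (mulCoeff L c t) w = V.action (mulCoeff L d t) w := by
  have h := hI.action_mulCoeff hcd t w
  have hsub : mulCoeff L (c - d) t = mulCoeff L c t - mulCoeff L d t := by
    clear h
    induction t with
    | zero => simp
    | add s t hs ht =>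
      rw [map_add, map_add, map_add, hs, ht]
      abel
    | tmul x a => rw [mulCoeff_tmul, mulCoeff_tmul, mulCoeff_tmul, sub_mul, TensorProduct.tmul_sub]
  rwa [hsub, map_sub, LinearMap.sub_apply, sub_eq_zero] at h

/-- The `L`-module on `V` given by `x ↦ x ⊗ e` for an idempotent `e` modulo the annihilator. -/
def idempotentModule (V : SuperModule.{v} (L ⊗[ℂ] A)) {I : Ideal A} (hI : V.KilledBy I) {e : A}
    (he : e * e - e ∈ I) : SuperModule.{v} L where
  carrier := V.carrier
  space := V.space
  action := V.action ∘ₗ mulCoeff L e ∘ₗ (TensorProduct.mk ℂ L A).flip 1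
  action_mem hx hw := V.action_mem (mulCoeff_mem (tmul_mem_part hx 1)) hw
  action_bracket {i j x y} hx hy w := by
    have h := V.action_bracket (mulCoeff_mem (c := e) (tmul_mem_part hx (1 : A)))
      (mulCoeff_mem (c := e) (tmul_mem_part hy (1 : A))) w
    rw [bracket_mulCoeff, hI.action_congr he, bracket_tmul, mul_one] at h
    exact h

/-- The complementary action of `L ⊗ A` on `V`. -/
def complementAction (V : SuperModule.{v} (L ⊗[ℂ] A)) {I : Ideal A} (hI : V.KilledBy I) {e : A}
    (he : e * e - e ∈ I) : CommutingAction (L ⊗[ℂ] A) (V.idempotentModule hI he) where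
  action := V.action ∘ₗ mulCoeff L (1 - e)
  action_mem hy hw := V.action_mem (mulCoeff_mem hy) hw
  action_bracket {i j x y} hx hy w := by
    have h := V.action_bracket (mulCoeff_mem (c := 1 - e) hx) (mulCoeff_mem (c := 1 - e) hy) w
    rw [bracket_mulCoeff] at h
    have hmem : (1 - e) * (1 - e) - (1 - e) ∈ I := by convert he using 1; ring
    exact (hI.action_congr hmem (bracket x y) w).symm.trans h
  commute {i j x y} hx hy w := by
    have h := V.action_action (mulCoeff_mem (c := e) (tmul_mem_part hx (1 : A)))
      (mulCoeff_mem (c := 1 - e) hy) w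
    rw [bracket_mulCoeff] at h
    -- Orthogonality of `e` and `1 - e` modulo `I` is what makes the two actions supercommute.
    have hmem : e * (1 - e) ∈ I := by convert I.neg_mem he using 1; ring
    have h0 := hI.action_mulCoeff hmem (bracket (x ⊗ₜ[ℂ] (1 : A)) y) w
    exact h.trans ((congrArg (· + _) h0).trans (zero_add _))

variable [Algebra.FiniteType ℂ A]

theorem evaluation_tmul (m : MaximalSpectrum A) (x : L) (a : A) :
    (evaluation L m).toLinearMap (x ⊗ₜ a) = residueMap m a • x := rfl

/-- A module killed by a maximal ideal is an evaluation module. -/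
theorem exists_iso_evaluationModule (V : SuperModule.{v} (L ⊗[ℂ] A)) (m : MaximalSpectrum A)
    (hm : V.KilledBy m.asIdeal) (hfin : FiniteDimensional ℂ V.carrier) (hV : V.IsIrreducible) :
    ∃ W : SuperModule.{v} L, FiniteDimensional ℂ W.carrier ∧ W.IsIrreducible ∧
      Nonempty (Iso V (evaluationModule m W)) := by
  -- The idempotent `1` gives the `L`-module on `V` in which `x` acts as `x ⊗ 1`.
  have h1 : (1 : A) * 1 - 1 ∈ m.asIdeal := by simp
  let W := V.idempotentModule hm h1
  have hact : ∀ (t : L ⊗[ℂ] A) (w : V.carrier),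
      V.action t w = V.action (mulCoeff L 1 ((evaluation L m).toLinearMap t ⊗ₜ 1)) w := by
    intro t w
    induction t with
    | zero => simp
    | add s t hs ht => simp only [map_add, LinearMap.add_apply, TensorProduct.add_tmul, hs, ht]
    | tmul x a =>
      have h := hm _ (sub_algebraMap_residueMap_mem m a) x w
      rw [TensorProduct.tmul_sub, map_sub, LinearMap.sub_apply, sub_eq_zero] at h
      rw [h, evaluation_tmul, mulCoeff_tmul, one_mul, TensorProduct.smul_tmul,
        ← Algebra.algebraMap_eq_smul_one]
  refine ⟨W, hfin, ⟨hV.1, fun N hN => ?_⟩,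
    ⟨{ toLinearEquiv := LinearEquiv.refl ℂ V.carrier, map_mem := fun h => h, map_action := hact }⟩⟩
  exact hV.2 N ⟨hN.1, fun t w hw => (hact t w).symm ▸ hN.2 _ w hw⟩

/-- An irreducible module killed by a finite intersection of maximal ideals is a tensor product
of evaluation modules. -/
theorem exists_iso_tensorFamily {h : L} (hh : IsRegular h) : ∀ (ℓ : ℕ)
    (m : Fin (ℓ + 1) → MaximalSpectrum A) (_ : Function.Injective m)
    (V : SuperModule.{v} (L ⊗[ℂ] A)) (_ : FiniteDimensional ℂ V.carrier) (_ : V.IsIrreducible)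
    (_ : V.KilledBy (⨅ i, (m i).asIdeal)),
    ∃ W : Fin (ℓ + 1) → SuperModule.{v} L,
      (∀ i, FiniteDimensional ℂ (W i).carrier ∧ (W i).IsIrreducible) ∧
      Nonempty (Iso V (tensorFamily (ℓ + 1) fun i => evaluationModule (m i) (W i))) := by
  intro ℓ
  induction ℓ with
  | zero =>
    intro m _ V hfin hV hm
    obtain ⟨W, hW, hWirr, ⟨e⟩⟩ := V.exists_iso_evaluationModule (m 0)
      (fun a ha => hm a (by simpa [Submodule.mem_iInf] using ha)) hfin hV
    exact ⟨fun _ => W, fun _ => ⟨hW, hWirr⟩, ⟨e.trans (tensorTrivialIso _).symm⟩⟩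
  | succ ℓ ih =>
    intro m hminj V hfin hV hm
    -- By the Chinese remainder theorem there is an `e` congruent to `1` modulo the first maximal
    -- ideal and to `0` modulo all others.
    obtain ⟨e, he⟩ := Ideal.exists_forall_sub_mem_ideal (I := fun i => (m i).asIdeal)
      (fun i j hij => Ideal.isCoprime_of_isMaximal
        fun h => hij (hminj (MaximalSpectrum.ext h))) (fun i => if i = 0 then 1 else 0)
    have he0 : e - 1 ∈ (m 0).asIdeal := by simpa using he 0
    have hes : ∀ i : Fin (ℓ + 1), e ∈ (m i.succ).asIdeal := fun i => by
      simpa [Fin.succ_ne_zero] using he i.succ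
    have hidem : e * e - e ∈ ⨅ i, (m i).asIdeal := by
      rw [Submodule.mem_iInf]
      intro i
      rw [show e * e - e = e * (e - 1) by ring]
      refine Fin.cases ?_ (fun i => ?_) i
      · exact Ideal.mul_mem_left _ _ he0
      · exact Ideal.mul_mem_right _ _ (hes i)
    -- Write `a = ea + (1 - e)a`. In the first summand `a` may be replaced by its residue at the
    -- first maximal ideal, since the difference times `e` lies in every ideal of the family.
    have hact : ∀ (t : L ⊗[ℂ] A) (w : V.carrier), V.action t w =
        V.action (mulCoeff L e ((evaluation L (m 0)).toLinearMap t ⊗ₜ 1)) w +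
          V.action (mulCoeff L (1 - e) t) w := by
      intro t w
      induction t with
      | zero => simp
      | add s t hs ht =>
        simp only [map_add, LinearMap.add_apply, TensorProduct.add_tmul, hs, ht]
        abel
      | tmul x a =>
        have hmem : e * (a - algebraMap ℂ A (residueMap (m 0) a)) ∈ ⨅ i, (m i).asIdeal := by
          rw [Submodule.mem_iInf]
          intro i
          refine Fin.cases ?_ (fun i => ?_) i
          · exact Ideal.mul_mem_left _ _ (sub_algebraMap_residueMap_mem _ _)
          · exact Ideal.mul_mem_right _ _ (hes i)
        have h := hm _ hmem x w
        rw [mul_sub, TensorProduct.tmul_sub, map_sub, LinearMap.sub_apply, sub_eq_zero] at h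
        rw [evaluation_tmul, mulCoeff_tmul, mulCoeff_tmul, sub_mul, one_mul,
          TensorProduct.tmul_sub, map_sub, LinearMap.sub_apply, h, TensorProduct.smul_tmul,
          ← mul_smul_comm, ← Algebra.algebraMap_eq_smul_one]
        abel
    let ρ := V.complementAction hm hidem
    have hXfin : FiniteDimensional ℂ (V.idempotentModule hm hidem).carrier := hfin
    obtain ⟨W, hWfin, hW, hUfin, hU, ⟨f⟩⟩ := exists_tensor_factorization V hV
      (evaluation L (m 0)) ρ (LinearEquiv.refl ℂ V.carrier) (fun i w hw => hw)
      hact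
      (fun W hW hWirr N hN => hWirr.ungraded hh N hN)
    have hkill : (intertwinersModule W ρ).KilledBy (⨅ i : Fin (ℓ + 1), (m i.succ).asIdeal) := by
      intro a ha x f
      rw [Submodule.mem_iInf] at ha
      refine action_tmul_eq_zero_of_homogeneous _ (fun i x hx => ?_) x
      refine Subtype.ext (LinearMap.ext fun w => ?_)
      refine (intertwinersAction_apply W ρ (tmul_mem_part hx a) f w).trans ?_
      -- The complementary action uses the coefficient `(1 - e)a`. The factor `1 - e` lies in the
      -- first ideal and `a` in all others, so the second tensor factor no longer sees the first
      -- ideal.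
      have hmem : (1 - e) * a ∈ ⨅ i, (m i).asIdeal := by
        rw [Submodule.mem_iInf]
        intro i
        refine Fin.cases ?_ (fun i => ?_) i
        · refine Ideal.mul_mem_right _ _ ?_
          rw [← neg_sub]
          exact Ideal.neg_mem_iff _ |>.mpr he0
        · exact Ideal.mul_mem_left _ _ (ha i)
      exact hm _ hmem x _
    obtain ⟨W', hW', ⟨g⟩⟩ := ih (fun i => m i.succ) (hminj.comp (Fin.succ_injective _))
      (intertwinersModule W ρ) hUfin hU hkill
    refine ⟨Fin.cons W W', Fin.cases ⟨hWfin, hW⟩ hW', ⟨f.trans ?_⟩⟩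
    exact g.tensorLeft _

end SuperModule

end

/-! ### Classification of the irreducible modules of `p(n) ⊗ A` -/

theorem mainTheorem2 (n : ℕ) (hn : 2 ≤ n)
    (A : Type u) [CommRing A] [Nontrivial A] [Algebra ℂ A] [Algebra.FiniteType ℂ A]
    (V : SuperModule.{v} (periplectic n ⊗[ℂ] A)) (hfin : FiniteDimensional ℂ V.carrier)
    (hirr : V.IsIrreducible) :
    ∃ (ℓ : ℕ) (m : Fin ℓ → MaximalSpectrum A) (W : Fin ℓ → SuperModule.{v} (periplectic n)),
      Function.Injective m ∧
      (∀ i, FiniteDimensional ℂ (W i).carrier ∧ (W i).IsIrreducible) ∧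
      Nonempty (SuperModule.Iso V
        (SuperModule.tensorFamily ℓ fun i => evaluationModule (m i) (W i))) := by
  have hperf : SuperModule.PerfectlyGraded (periplectic n) := periplectic_part_le_span hn
  have := SuperModule.finiteDimensional_quotient_vanishingIdeal hperf V
  obtain ⟨ℓ, m, hm, hI⟩ := exists_maximalSpectrum_family (SuperModule.vanishingIdeal hperf V)
    (SuperModule.vanishingIdeal_isRadical hperf V hirr)
  obtain ⟨W, hW, hiso⟩ := SuperModule.exists_iso_tensorFamily
    (isRegular_periplecticElement hn) ℓ m hm V hfin hirr
    (fun a ha => hI a ((Submodule.mem_iInf _).mp ha))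
  exact ⟨ℓ + 1, m, W, hm, hW, hiso⟩
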